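/- Let $(M^n,g)$ be a smooth Riemannian manifold (without boundary; no completeness or connectedness is assumed), and let $f:M\to\mathbb R$ be a smooth function such that $(M,g,f)$ is a shrinking gradient Ricci soliton (a *shrinker*), normalized by $$Rc+\nabla^2 f=\tfrac12 g\qquad\text{and}\qquad R+|\nabla f|^2=f\qquad\text{on } M,$$ where $Rc$ and $R$ are the Ricci tensor and the scalar curvature of $g$. For a 2-tensor field $h$ put $$\Delta_f h=\Delta h-\nabla_{\nabla f}h,\qquad Rm[h]_{ij}=R^{a}{}_{i}{}^{b}{}_{j}\,h_{ab}=g^{ac}g^{bd}R_{cidj}h_{ab},$$ where $\Delta h_{ij}=g^{ab}\nabla_a\nabla_b h_{ij}$ and the sign of the curvature tensor is such that $g^{ab}R_{aibj}=Rc_{ij}$. A smooth symmetric 2-tensor field $h\not\equiv0$ on $M$ with $\Delta_f h+2Rm[h]=\lambda h$ on $M$ is called an eigenmode of the weighted Lichnerowicz Laplacian $\Delta_f+2Rm$ with eigenvalue $\lambda\in\mathbb R$. Then: 1. $\Delta_f Rc+2Rm[Rc]=Rc$ on $M$; hence, if $Rc\not\equiv0$, then $Rc$ is an eigenmode of the weighted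 Lichnerowicz Laplacian with eigenvalue $+1$. 2. $\Delta_f\nabla^2 f+2Rm[\nabla^2 f]=0$ on $M$; hence, if $\nabla^2 f\not\equiv0$, then $\nabla^2 f$ is an eigenmode of the weighted Lichnerowicz Laplacian with eigenvalue $0$. -/

import Mathlib

open scoped Manifold ContDiff Bundle

noncomputable section

namespace Shrinker

/-- Coordinate space. -/
abbrev Coord (n : ℕ) : Type := EuclideanSpace ℝ (Fin n)

/-! ### Tensor calculus in one coordinate system

A metric is given by its component functions `g y i j`; `(g y)⁻¹ i j` are the components `g^{ij}` of
the inverse matrix. -/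

namespace Local

variable {n : ℕ}

/-- The partial derivative `∂_i φ` at `y`. -/
def pd (i : Fin n) (φ : Coord n → ℝ) (y : Coord n) : ℝ :=
  fderiv ℝ φ y (EuclideanSpace.single i 1)

/-- Christoffel symbols of the Levi-Civita connection: `christoffel g k i j y` is
`Γ^k_{ij} = ½ g^{kl} (∂_i g_{jl} + ∂_j g_{il} - ∂_l g_{ij})`. -/
def christoffel (g : Coord n → Matrix (Fin n) (Fin n) ℝ) (k i j : Fin n) (y : Coord n) : ℝ :=
  (1 / 2 : ℝ) * ∑ l, (g y)⁻¹ k l *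
    (pd i (fun z ↦ g z j l) y + pd j (fun z ↦ g z i l) y - pd l (fun z ↦ g z i j) y)

/-- `riemannUp g i j k l y` is the component `R_{ijk}^l`, where
`∇_i ∇_j ∂_k - ∇_j ∇_i ∂_k = R_{ijk}^l ∂_l`. -/
def riemannUp (g : Coord n → Matrix (Fin n) (Fin n) ℝ) (i j k l : Fin n) (y : Coord n) : ℝ :=
  pd i (christoffel g l j k) y - pd j (christoffel g l i k) y
    + ∑ m, (christoffel g m j k y * christoffel g l i m y
      - christoffel g m i k y * christoffel g l j m y)

/-- The fully covariant curvature tensor `R_{ijkl} = ⟨R(∂_i, ∂_j) ∂_l, ∂_k⟩`, in the convention in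
which `R_{ijij}` is positive on round spheres and `g^{ab} R_{aibj} = R_{ij}`. -/
def riemann (g : Coord n → Matrix (Fin n) (Fin n) ℝ) (i j k l : Fin n) (y : Coord n) : ℝ :=
  ∑ m, g y k m * riemannUp g i j l m y

/-- The Ricci curvature `R_{ij} = R_{aij}^a`. -/
def ricci (g : Coord n → Matrix (Fin n) (Fin n) ℝ) (y : Coord n) : Matrix (Fin n) (Fin n) ℝ :=
  fun i j ↦ ∑ a, riemannUp g a i j a y

/-- The scalar curvature `R = g^{ij} R_{ij}`. -/
def scalar (g : Coord n → Matrix (Fin n) (Fin n) ℝ) (y : Coord n) : ℝ :=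
  ∑ i, ∑ j, (g y)⁻¹ i j * ricci g y i j

/-- `|∇ f|² = g^{ij} ∂_i f ∂_j f`. -/
def gradNormSq (g : Coord n → Matrix (Fin n) (Fin n) ℝ) (f : Coord n → ℝ) (y : Coord n) : ℝ :=
  ∑ i, ∑ j, (g y)⁻¹ i j * pd i f y * pd j f y

/-- `∇_i ∇_j f = ∂_i ∂_j f - Γ^k_{ij} ∂_k f`. -/
def hessian (g : Coord n → Matrix (Fin n) (Fin n) ℝ) (f : Coord n → ℝ) (y : Coord n) :
    Matrix (Fin n) (Fin n) ℝ :=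
  fun i j ↦ pd i (pd j f) y - ∑ k, christoffel g k i j y * pd k f y

/-- The covariant derivative of a covariant 2-tensor: `nabla₂ g h a i j y` is `∇_a h_{ij}`. -/
def nabla₂ (g h : Coord n → Matrix (Fin n) (Fin n) ℝ) (a i j : Fin n) (y : Coord n) : ℝ :=
  pd a (fun z ↦ h z i j) y
    - ∑ m, (christoffel g m a i y * h y m j + christoffel g m a j y * h y i m)

/-- The covariant derivative of a covariant 3-tensor: `nabla₃ g T a b i j y` is `∇_a T_{bij}`. -/
def nabla₃ (g : Coord n → Matrix (Fin n) (Fin n) ℝ) (T : Fin n → Fin n → Fin n → Coord n → ℝ)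
    (a b i j : Fin n) (y : Coord n) : ℝ :=
  pd a (T b i j) y
    - ∑ m, (christoffel g m a b y * T m i j y + christoffel g m a i y * T b m j y
      + christoffel g m a j y * T b i m y)

/-- The rough Laplacian `(Δ h)_{ij} = g^{ab} ∇_a ∇_b h_{ij}`. -/
def laplacian (g h : Coord n → Matrix (Fin n) (Fin n) ℝ) (y : Coord n) :
    Matrix (Fin n) (Fin n) ℝ :=
  fun i j ↦ ∑ a, ∑ b, (g y)⁻¹ a b * nabla₃ g (nabla₂ g h) a b i j y

/-- `(∇_{∇ f} h)_{ij} = g^{ab} ∂_b f ∇_a h_{ij}`. -/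
def nablaGrad (g : Coord n → Matrix (Fin n) (Fin n) ℝ) (f : Coord n → ℝ)
    (h : Coord n → Matrix (Fin n) (Fin n) ℝ) (y : Coord n) : Matrix (Fin n) (Fin n) ℝ :=
  fun i j ↦ ∑ a, ∑ b, (g y)⁻¹ a b * pd b f y * nabla₂ g h a i j y

/-- `Rm[h]_{ij} = g^{ac} g^{bd} R_{cidj} h_{ab}`. -/
def rmAction (g h : Coord n → Matrix (Fin n) (Fin n) ℝ) (y : Coord n) :
    Matrix (Fin n) (Fin n) ℝ :=
  fun i j ↦ ∑ a, ∑ b, ∑ c, ∑ d, (g y)⁻¹ a c * (g y)⁻¹ b d * riemann g c i d j y * h y a b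

end Local

/-! ### Tensors on a manifold

A tensor built from coordinate expressions is evaluated at `x` in the chart `chartAt _ x` around `x`
(the expressions above are tensorial, so any other chart around `x` gives the same value). -/

variable {n : ℕ} {M : Type*} [TopologicalSpace M] [ChartedSpace (Coord n) M]

variable (n M) in
/-- Fields of bilinear forms on the tangent spaces (covariant 2-tensor fields). -/
abbrev Tensor2 : Type _ :=
  ∀ x : M, TangentSpace (𝓡 n) x →L[ℝ] TangentSpace (𝓡 n) x →L[ℝ] ℝ

variable (n M) in
/-- Smooth Riemannian metrics on `M`. -/
abbrev Metric [IsManifold (𝓡 n) ∞ M] : Type _ :=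
  Bundle.ContMDiffRiemannianMetric (𝓡 n) ∞ (Coord n) (fun x : M ↦ TangentSpace (𝓡 n) x)

/-- The components `h_{ij} = h(∂_i, ∂_j)` of a 2-tensor field in the chart `e`, where the coordinate
vector field `∂_i` is the image of the `i`-th standard basis vector under the derivative
of `e.symm`. -/
def comp (e : OpenPartialHomeomorph M (Coord n)) (h : Tensor2 n M) (y : Coord n) :
    Matrix (Fin n) (Fin n) ℝ :=
  fun i j ↦ h (e.symm y) (mfderiv (𝓡 n) (𝓡 n) e.symm y (EuclideanSpace.single i 1))
    (mfderiv (𝓡 n) (𝓡 n) e.symm y (EuclideanSpace.single j 1))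

variable (n) in
/-- The coordinate covector `dx^i` at `x`, in the chart around `x`. -/
def dcoord (x : M) (i : Fin n) : TangentSpace (𝓡 n) x →L[ℝ] ℝ :=
  (EuclideanSpace.proj i : Coord n →L[ℝ] ℝ).comp
    (mfderiv (𝓡 n) (𝓡 n) (chartAt (Coord n) x) x : TangentSpace (𝓡 n) x →L[ℝ] Coord n)

/-- The bilinear form `a_{ij} dx^i ⊗ dx^j` at `x`, in the chart around `x`. -/
def ofComp (x : M) (a : Matrix (Fin n) (Fin n) ℝ) :
    TangentSpace (𝓡 n) x →L[ℝ] TangentSpace (𝓡 n) x →L[ℝ] ℝ :=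
  ∑ i, ∑ j, a i j • (dcoord n x i).smulRight (dcoord n x j)

/-- The coordinates of `x` in the chart around `x`. -/
abbrev coords (x : M) : Coord n := chartAt (Coord n) x x

/-- A function on `M` in the coordinates of the chart around `x`. -/
abbrev fnAt (x : M) (f : M → ℝ) : Coord n → ℝ := f ∘ (chartAt (Coord n) x).symm

/-- The components of a 2-tensor field in the chart around `x`. -/
abbrev compAt (x : M) (h : Tensor2 n M) : Coord n → Matrix (Fin n) (Fin n) ℝ :=
  comp (chartAt (Coord n) x) h

/-- `h` is a smooth section of the bundle of symmetric 2-tensors. -/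
structure IsSmoothSym [IsManifold (𝓡 n) ∞ M] (h : Tensor2 n M) : Prop where
  smooth : ContMDiff (𝓡 n) ((𝓡 n).prod 𝓘(ℝ, Coord n →L[ℝ] Coord n →L[ℝ] ℝ)) ∞
    (fun x ↦ Bundle.TotalSpace.mk' (Coord n →L[ℝ] Coord n →L[ℝ] ℝ)
      (E := fun x : M ↦ TangentSpace (𝓡 n) x →L[ℝ] TangentSpace (𝓡 n) x →L[ℝ] ℝ) x (h x))
  symm : ∀ x v w, h x v w = h x w v

variable [IsManifold (𝓡 n) ∞ M]

/-- The Ricci tensor `Rc`. -/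
def ricci (g : Metric n M) : Tensor2 n M :=
  fun x ↦ ofComp x (Local.ricci (compAt x g.inner) (coords x))

/-- The scalar curvature `R`. -/
def scalarCurvature (g : Metric n M) (x : M) : ℝ :=
  Local.scalar (compAt x g.inner) (coords x)

/-- `|∇ f|²`. -/
def gradNormSq (g : Metric n M) (f : M → ℝ) (x : M) : ℝ :=
  Local.gradNormSq (compAt x g.inner) (fnAt x f) (coords x)

/-- The Hessian `∇² f`. -/
def hessian (g : Metric n M) (f : M → ℝ) : Tensor2 n M :=
  fun x ↦ ofComp x (Local.hessian (compAt x g.inner) (fnAt x f) (coords x))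

/-- The rough Laplacian `Δ h`. -/
def laplacian (g : Metric n M) (h : Tensor2 n M) : Tensor2 n M :=
  fun x ↦ ofComp x (Local.laplacian (compAt x g.inner) (compAt x h) (coords x))

/-- The derivative `∇_{∇ f} h`. -/
def nablaGrad (g : Metric n M) (f : M → ℝ) (h : Tensor2 n M) : Tensor2 n M :=
  fun x ↦ ofComp x (Local.nablaGrad (compAt x g.inner) (fnAt x f) (compAt x h) (coords x))

/-- The weighted Laplacian `Δ_f h = Δ h - ∇_{∇ f} h`. -/
def weightedLaplacian (g : Metric n M) (f : M → ℝ) (h : Tensor2 n M) : Tensor2 n M :=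
  fun x ↦ laplacian g h x - nablaGrad g f h x

/-- The curvature action `Rm[h]`. -/
def rmAction (g : Metric n M) (h : Tensor2 n M) : Tensor2 n M :=
  fun x ↦ ofComp x (Local.rmAction (compAt x g.inner) (compAt x h) (coords x))

/-- The weighted Lichnerowicz Laplacian `Δ_f h + 2 Rm[h]`. -/
def weightedLichnerowicz (g : Metric n M) (f : M → ℝ) (h : Tensor2 n M) : Tensor2 n M :=
  fun x ↦ weightedLaplacian g f h x + (2 : ℝ) • rmAction g h x

/-- `(M, g, f)` is a shrinking gradient Ricci soliton, normalized by `Rc + ∇² f = ½ g`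
and `R + |∇ f|² = f`. -/
structure IsShrinker (g : Metric n M) (f : M → ℝ) : Prop where
  smooth : ContMDiff (𝓡 n) 𝓘(ℝ, ℝ) ∞ f
  soliton : ∀ x, ricci g x + hessian g f x = (1 / 2 : ℝ) • g.inner x
  normalized : ∀ x, scalarCurvature g x + gradNormSq g f x = f x

/-- `h` is an eigenmode of the weighted Lichnerowicz Laplacian with eigenvalue `μ`: a smooth
symmetric 2-tensor field, not identically zero, with `Δ_f h + 2 Rm[h] = μ h`. -/
structure IsEigenmode (g : Metric n M) (f : M → ℝ) (h : Tensor2 n M) (μ : ℝ) : Prop where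
  smoothSym : IsSmoothSym h
  ne_zero : ∃ x, h x ≠ 0
  eigen : ∀ x, weightedLichnerowicz g f h x = μ • h x

end Shrinker

end

/-!
The computation rests on the equation for the Hessian `H = ∇² f`. By the Ricci identity
`∇_a H_{ij} = ∇_i H_{aj} - R_{aij}^l ∂_l f`, and taking the divergence in `a`,

`ΔH_{ij} = ∇^a ∇_i H_{aj} - ∇^a (R_{aij}^l ∂_l f)`.

In the first term the derivatives are commuted: it becomes `∇_i (div H)_j`, plus `Rc ∘ H`, minus
`Rm[H]`. In the second term the contracted second Bianchi identity gives
`∇^a R_{aijl} = ∇_l Rc_{ji} - ∇_j Rc_{li}`, and the Leibniz rule contributes `Rm[H]`. The soliton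
equation replaces `Rc` by `½ g - H`. The divergence of `H` is `∇ Δf + Rc(∇f)`, where the trace of
the soliton equation and the normalization `R + |∇f|² = f` give `∇ Δf = -∇f + 2 H(∇f)`, so that
`div H = H(∇f) - ½ ∇f`. Collecting terms leaves `ΔH = ∇_{∇f} H - 2 Rm[H]`. The equation for `Rc`
follows by linearity from `Rc = ½ g - H`, because `∇g = 0` and `Rm[g] = Rc`. These two statements
are `IsLeviCivita.lichnerowicz_hessian` and `IsLeviCivita.lichnerowicz_ricci`.

The tensor calculus is carried out algebraically, over a commutative algebra `A` with commuting
derivations `d i`. For a fixed direction `i`, the Christoffel symbols form a matrix `conn Γ i` over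
`A` acting on covectors, the curvature is minus the commutator of the operators `d i - conn Γ i`; the
Bianchi and Ricci identities are identities in the ring of matrices. Taking for `A` the smooth
functions on an open subset of the coordinate space transfers the results to coordinates, without
any differentiability side conditions.

The tensor fields `Rc` and `∇² f` are evaluated at each point in the preferred chart of that point,
whereas the Laplacian differentiates their components in one fixed chart. Hence the Ricci
tensor, the Hessian, the scalar curvature and `|∇f|²` have to be shown to be independent of the
chart. In the algebraic setting, a change of coordinates acts on the connection matrices as a gauge
transformation by the Jacobian (`conn_mul_jacobian`, from the uniqueness of the Levi-Civita
connection), so the curvature matrices are conjugated by the Jacobian.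
-/

/-! ### Connections, curvature and the Bianchi identities -/

namespace Shrinker.Formal

/-- In an algebra over `ℝ`, an element equal to its negative vanishes. -/
lemma eq_zero_of_eq_neg {A : Type*} [CommRing A] [Algebra ℝ A] {s : A} (h : s = -s) : s = 0 := by
  have h2 : (2 : ℝ) • s = 0 := by
    rw [two_smul]
    nth_rewrite 2 [h]
    exact add_neg_cancel s
  calc s = (1 / 2 : ℝ) • (2 : ℝ) • s := by rw [smul_smul]; norm_num
    _ = 0 := by rw [h2, smul_zero]

section Derivations

variable {A ι : Type*} [CommRing A] [Algebra ℝ A]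

/-- Entrywise application of a derivation to a matrix. -/
def dMat (δ : Derivation ℝ A A) (S : Matrix ι ι A) : Matrix ι ι A := S.map δ

@[simp] lemma dMat_apply (δ : Derivation ℝ A A) (S : Matrix ι ι A) (i j : ι) :
    dMat δ S i j = δ (S i j) := rfl

lemma dMat_add (δ : Derivation ℝ A A) (S T : Matrix ι ι A) :
    dMat δ (S + T) = dMat δ S + dMat δ T := by
  ext; simp

lemma dMat_sub (δ : Derivation ℝ A A) (S T : Matrix ι ι A) :
    dMat δ (S - T) = dMat δ S - dMat δ T := by
  ext; simp

lemma dMat_smul (δ : Derivation ℝ A A) (c : ℝ) (S : Matrix ι ι A) :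
    dMat δ (c • S) = c • dMat δ S := by
  ext; simp

lemma dMat_transpose (δ : Derivation ℝ A A) (S : Matrix ι ι A) :
    dMat δ S.transpose = (dMat δ S).transpose := rfl

lemma dMat_comm {δ δ' : Derivation ℝ A A} (h : ∀ φ, δ (δ' φ) = δ' (δ φ)) (S : Matrix ι ι A) :
    dMat δ (dMat δ' S) = dMat δ' (dMat δ S) := by
  ext i j; exact h _

lemma dMat_one [DecidableEq ι] (δ : Derivation ℝ A A) : dMat δ (1 : Matrix ι ι A) = 0 := by
  ext i j
  by_cases h : i = j <;> simp [h]

lemma dMat_mul [Fintype ι] (δ : Derivation ℝ A A) (S T : Matrix ι ι A) :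
    dMat δ (S * T) = dMat δ S * T + S * dMat δ T := by
  ext i j
  simp only [dMat_apply, Matrix.mul_apply, Matrix.add_apply, map_sum, Derivation.leibniz,
    smul_eq_mul, Finset.sum_add_distrib]
  rw [add_comm]
  congr 1
  exact Finset.sum_congr rfl fun _ _ ↦ mul_comm _ _

lemma derivation_mulVec [Fintype ι] (δ : Derivation ℝ A A) (S : Matrix ι ι A) (u : ι → A) :
    (fun k ↦ δ (S.mulVec u k)) = (dMat δ S).mulVec u + S.mulVec (fun k ↦ δ (u k)) := by
  ext i
  simp only [Matrix.mulVec, dotProduct, dMat_apply, Pi.add_apply, map_sum, Derivation.leibniz,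
    smul_eq_mul, Finset.sum_add_distrib]
  rw [add_comm]
  congr 1
  exact Finset.sum_congr rfl fun _ _ ↦ mul_comm _ _

end Derivations

section Connection

/-- The connection matrix in the direction `i`: its `(k, m)` entry is `Γ^m_{ik}`, so that the
covariant derivative of a 1-form `ω` in the direction `i` is `∂_i ω - (conn Γ i) ω`. -/
def conn {A ι : Type*} (Γ : ι → ι → ι → A) (i : ι) : Matrix ι ι A := Matrix.of fun k m ↦ Γ m i k

@[simp] lemma conn_apply {A ι : Type*} (Γ : ι → ι → ι → A) (i k m : ι) :
    conn Γ i k m = Γ m i k := rfl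

variable {A ι : Type*} [CommRing A] [Algebra ℝ A] [Fintype ι]
  (d : ι → Derivation ℝ A A) (Γ : ι → ι → ι → A)

/-- The covariant derivative `∇_i S` of a covariant 2-tensor `S`, as a matrix. -/
def covD (i : ι) (S : Matrix ι ι A) : Matrix ι ι A :=
  dMat (d i) S - conn Γ i * S - S * (conn Γ i).transpose

lemma covD_apply (a : ι) (h : Matrix ι ι A) (i j : ι) : covD d Γ a h i j
    = d a (h i j) - ∑ m, (Γ m a i * h m j + Γ m a j * h i m) := by
  simp only [covD, Matrix.sub_apply, dMat_apply, Matrix.mul_apply, conn_apply,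
    Matrix.transpose_apply, Finset.sum_add_distrib, sub_sub, mul_comm (h i _)]

lemma covD_sub (i : ι) (S T : Matrix ι ι A) :
    covD d Γ i (S - T) = covD d Γ i S - covD d Γ i T := by
  simp only [covD, dMat_sub]; noncomm_ring

lemma covD_smul (i : ι) (c : ℝ) (S : Matrix ι ι A) :
    covD d Γ i (c • S) = c • covD d Γ i S := by
  rw [covD, covD, dMat_smul, Matrix.mul_smul, Matrix.smul_mul, ← smul_sub, ← smul_sub]

/-- The curvature matrix in the directions `i, j`: its `(k, l)` entry is `R_{ijk}^l`. -/
def curv (i j : ι) : Matrix ι ι A :=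
  dMat (d i) (conn Γ j) - dMat (d j) (conn Γ i) - (conn Γ i * conn Γ j - conn Γ j * conn Γ i)

lemma curv_apply (i j k l : ι) : curv d Γ i j k l
    = d i (Γ l j k) - d j (Γ l i k) + ∑ m, (Γ m j k * Γ l i m - Γ m i k * Γ l j m) := by
  simp only [curv, Matrix.sub_apply, dMat_apply, Matrix.mul_apply, conn_apply,
    Finset.sum_sub_distrib]
  ring

lemma curv_swap (i j : ι) : curv d Γ i j = -curv d Γ j i := by
  simp only [curv]; noncomm_ring

/-- The covariant derivative `∇_a T_{bij}` of a covariant 3-tensor `T`. -/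
def nabla₃ (T : ι → ι → ι → A) (a b i j : ι) : A :=
  d a (T b i j) - ∑ m, (Γ m a b * T m i j + Γ m a i * T b m j + Γ m a j * T b i m)

lemma nabla₃_eq_covD (T : ι → ι → ι → A) (a b i j : ι) : nabla₃ d Γ T a b i j
    = covD d Γ a (Matrix.of (T b)) i j - ∑ m, Γ m a b * T m i j := by
  simp only [nabla₃, covD_apply, Matrix.of_apply, Finset.sum_add_distrib]
  ring

lemma nabla₃_swap (T : ι → ι → ι → A) (a b i j : ι) :
    nabla₃ d Γ (fun b i j ↦ T i b j) a b i j = nabla₃ d Γ T a i b j := by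
  simp only [nabla₃, Finset.sum_add_distrib]
  ring

lemma nabla₃_sub (T T' : ι → ι → ι → A) (a b i j : ι) :
    nabla₃ d Γ (fun b i j ↦ T b i j - T' b i j) a b i j
      = nabla₃ d Γ T a b i j - nabla₃ d Γ T' a b i j := by
  simp only [nabla₃, map_sub, mul_sub, Finset.sum_add_distrib, Finset.sum_sub_distrib]
  ring

/-- The covariant derivative `∇_b Q_{aijl}` of a covariant 4-tensor. -/
def nabla₄ (Q : ι → ι → ι → ι → A) (b a i j l : ι) : A :=
  d b (Q a i j l) - ∑ m, (Γ m b a * Q m i j l + Γ m b i * Q a m j l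
    + Γ m b j * Q a i m l + Γ m b l * Q a i j m)

lemma nabla₄_eq_covD (Q : ι → ι → Matrix ι ι A) (b a i j l : ι) :
    nabla₄ d Γ (fun a i ↦ Q a i) b a i j l = covD d Γ b (Q a i) j l - ∑ m, (Γ m b a * Q m i j l + Γ m b i * Q a m j l) := by
  simp only [nabla₄, covD_apply, Finset.sum_add_distrib]
  ring

variable {d} in
/-- Ricci identity for covariant 2-tensors. -/
lemma covD_commutator (hd : ∀ i j φ, d i (d j φ) = d j (d i φ)) (a b : ι) (S : Matrix ι ι A) :
    covD d Γ a (covD d Γ b S) - covD d Γ b (covD d Γ a S)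
      = -(curv d Γ a b * S) - S * (curv d Γ a b).transpose := by
  simp only [covD, curv, dMat_sub, dMat_mul, dMat_transpose, dMat_comm (hd a b),
    Matrix.transpose_sub, Matrix.transpose_mul]
  noncomm_ring

variable {d} in
/-- The differential Bianchi identity: the Jacobi identity for the operators `∂_i - conn Γ i`. -/
lemma curv_bianchi (hd : ∀ i j φ, d i (d j φ) = d j (d i φ)) (a b c : ι) :
    (dMat (d a) (curv d Γ b c) - conn Γ a * curv d Γ b c + curv d Γ b c * conn Γ a)
      + (dMat (d b) (curv d Γ c a) - conn Γ b * curv d Γ c a + curv d Γ c a * conn Γ b)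
      + (dMat (d c) (curv d Γ a b) - conn Γ c * curv d Γ a b + curv d Γ a b * conn Γ c) = 0 := by
  simp only [curv, dMat_sub, dMat_mul, dMat_comm (hd a b), dMat_comm (hd b c), dMat_comm (hd a c)]
  noncomm_ring

variable {d Γ} in
/-- The algebraic Bianchi identity of a torsion-free connection. -/
lemma curv_cyclic (hΓ : ∀ k i j, Γ k i j = Γ k j i) (a b c l : ι) :
    curv d Γ a b c l + curv d Γ b c a l + curv d Γ c a b l = 0 := by
  simp only [curv_apply, Finset.sum_sub_distrib, hΓ _ b a, hΓ _ c a, hΓ _ c b]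
  ring

variable [DecidableEq ι]

/-- `Γ` is the Levi-Civita connection of the symmetric matrix `g` with inverse `G`, with respect
to the commuting derivations `d i`. -/
structure IsLeviCivita (g G : Matrix ι ι A) : Prop where
  comm : ∀ i j φ, d i (d j φ) = d j (d i φ)
  symm : g.transpose = g
  inv : G * g = 1
  torsion : ∀ k i j, Γ k i j = Γ k j i
  compat : ∀ i, dMat (d i) g = conn Γ i * g + g * (conn Γ i).transpose

namespace IsLeviCivita

variable {d Γ} {g G : Matrix ι ι A} (h : IsLeviCivita d Γ g G)
include h

lemma inv' : g * G = 1 := mul_eq_one_comm.mp h.inv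

lemma inv_symm : G.transpose = G := by
  have h1 : g * G.transpose = 1 := by
    rw [← h.symm, ← Matrix.transpose_mul, h.inv, Matrix.transpose_one]
  calc G.transpose = (G * g) * G.transpose := by rw [h.inv, one_mul]
    _ = G := by rw [mul_assoc, h1, mul_one]

lemma symm_apply (i j : ι) : g i j = g j i := congrFun₂ h.symm.symm i j

lemma inv_symm_apply (i j : ι) : G i j = G j i := congrFun₂ h.inv_symm.symm i j

lemma covD_metric (i : ι) : covD d Γ i g = 0 := by
  rw [covD, h.compat]; abel

lemma dMat_inv (i : ι) : dMat (d i) G = -((conn Γ i).transpose * G) - G * conn Γ i := by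
  have h1 : dMat (d i) G * g + G * dMat (d i) g = 0 := by
    rw [← dMat_mul, h.inv, dMat_one]
  rw [h.compat] at h1
  calc dMat (d i) G = (dMat (d i) G * g + G * (conn Γ i * g + g * (conn Γ i).transpose)) * G
        - G * conn Γ i * (g * G) - (G * g) * (conn Γ i).transpose * G
        + dMat (d i) G * (1 - g * G) := by noncomm_ring
    _ = _ := by rw [h1, h.inv, h.inv']; noncomm_ring

/-- Contraction of two indices commutes with covariant differentiation. -/
lemma derivation_trace (i : ι) (S : Matrix ι ι A) :
    d i (∑ a, ∑ b, G a b * S a b) = ∑ a, ∑ b, G a b * covD d Γ i S a b := by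
  have key (T : Matrix ι ι A) : ∑ a, ∑ b, G a b * T a b = (G * T.transpose).trace := by
    simp [Matrix.trace, Matrix.mul_apply]
  have hd (T : Matrix ι ι A) : d i T.trace = (dMat (d i) T).trace := by
    simp [Matrix.trace]
  rw [key, key, hd, dMat_mul, h.dMat_inv, dMat_transpose, covD, Matrix.transpose_sub,
    Matrix.transpose_sub, Matrix.transpose_mul, Matrix.transpose_mul, Matrix.transpose_transpose,
    sub_mul, neg_mul, mul_assoc _ G, mul_sub, mul_sub]
  simp only [Matrix.trace_add, Matrix.trace_sub, Matrix.trace_neg]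
  rw [Matrix.trace_mul_comm (conn Γ i).transpose, mul_assoc, mul_assoc]
  ring

/-- The fully covariant curvature `R_{abkl} = R_{abk}^m g_{ml}`, written `(curv d Γ a b * g) k l`, is
skew in its last two indices: apply the Ricci identity to the parallel tensor `g`. The upper index
is lowered into the last slot, so `Local.riemann g a b k l` corresponds to `R_{ablk}`. -/
lemma curv_mul_metric_skew (a b : ι) :
    (curv d Γ a b * g).transpose = -(curv d Γ a b * g) := by
  have h1 := covD_commutator Γ h.comm a b g
  simp only [h.covD_metric] at h1
  have h0 (i : ι) : covD d Γ i (0 : Matrix ι ι A) = 0 := by ext; simp [covD_apply]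
  rw [h0, h0, sub_self] at h1
  rw [Matrix.transpose_mul, h.symm]
  exact (sub_eq_zero.mp h1.symm).symm

lemma riem_skew_right (a b k l : ι) :
    (curv d Γ a b * g) k l = -(curv d Γ a b * g) l k :=
  congrFun₂ (h.curv_mul_metric_skew a b) l k

omit [DecidableEq ι] h in
lemma riem_skew_left (a b k l : ι) :
    (curv d Γ a b * g) k l = -(curv d Γ b a * g) k l := by
  rw [curv_swap, neg_mul, Matrix.neg_apply]

lemma riem_cyclic (a b c l : ι) :
    (curv d Γ a b * g) c l + (curv d Γ b c * g) a l + (curv d Γ c a * g) b l = 0 := by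
  simp only [Matrix.mul_apply, ← Finset.sum_add_distrib, ← add_mul, curv_cyclic h.torsion,
    zero_mul, Finset.sum_const_zero]

/-- The pair symmetry `R_{abkl} = R_{klab}`. -/
lemma riem_pair_symm (a b k l : ι) :
    (curv d Γ a b * g) k l = (curv d Γ k l * g) a b := by
  refine sub_eq_zero.mp (eq_zero_of_eq_neg ?_)
  -- the four cyclic identities at the vertices of Milnor's octahedron, up to skew-symmetries
  linear_combination h.riem_cyclic a b k l + h.riem_cyclic b k l a - h.riem_cyclic k l a b
    - h.riem_cyclic l a b k + h.riem_skew_right a b k l - h.riem_skew_right k l a b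
    - h.riem_skew_right b k a l + h.riem_skew_right l a k b
    + riem_skew_left (d := d) (Γ := Γ) (g := g) a k l b - h.riem_skew_right k a l b
    + riem_skew_left (d := d) (Γ := Γ) (g := g) b l a k - h.riem_skew_right l b a k

/-- The second Bianchi identity for the fully covariant curvature tensor. -/
lemma nabla₄_riem_cyclic (a b c k l : ι) :
    nabla₄ d Γ (fun a b ↦ curv d Γ a b * g) a b c k l
      + nabla₄ d Γ (fun a b ↦ curv d Γ a b * g) b c a k l
      + nabla₄ d Γ (fun a b ↦ curv d Γ a b * g) c a b k l = 0 := by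
  have hD (a b c : ι) : covD d Γ a (curv d Γ b c * g)
      = (dMat (d a) (curv d Γ b c) - conn Γ a * curv d Γ b c + curv d Γ b c * conn Γ a) * g := by
    rw [covD, dMat_mul, h.compat]; noncomm_ring
  have key : covD d Γ a (curv d Γ b c * g) + covD d Γ b (curv d Γ c a * g)
      + covD d Γ c (curv d Γ a b * g) = 0 := by
    rw [hD, hD, hD, ← add_mul, ← add_mul, curv_bianchi Γ h.comm, zero_mul]
  have key' := congrFun₂ key k l
  simp only [Matrix.add_apply, Matrix.zero_apply] at key'
  have e (x y z : ι) : ∑ m, (Γ m x y * (curv d Γ m z * g) k l)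
      = -∑ m, (Γ m y x * (curv d Γ z m * g) k l) := by
    rw [← Finset.sum_neg_distrib]
    refine Finset.sum_congr rfl fun m _ ↦ ?_
    rw [h.torsion m x y, riem_skew_left m z]; ring
  -- the Christoffel terms of the first two curvature indices cancel in pairs
  simp only [nabla₄_eq_covD, Finset.sum_add_distrib, e]
  linear_combination key'

/-- The Ricci tensor is the trace of the fully covariant curvature. -/
lemma ricci_eq_trace (i j : ι) :
    ∑ a, curv d Γ a i j a = ∑ a, ∑ b, G a b * (curv d Γ i a * g) b j := by
  have e (a : ι) : curv d Γ a i j a = ∑ b, (curv d Γ a i * g) j b * G b a := by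
    rw [← Matrix.mul_apply, mul_assoc, h.inv', mul_one]
  simp only [e]
  refine Finset.sum_congr rfl fun a _ ↦ Finset.sum_congr rfl fun b _ ↦ ?_
  rw [riem_skew_left, h.riem_skew_right, h.inv_symm_apply]; ring

end IsLeviCivita

end Connection

end Shrinker.Formal

/-! ### The Lichnerowicz equations of a shrinker -/

namespace Shrinker.Formal

lemma sum_rotate {A ι : Type*} [AddCommMonoid A] [Fintype ι] (F : ι → ι → ι → A) :
    ∑ a, ∑ b, ∑ p, F a b p = ∑ p, ∑ a, ∑ b, F a b p := by
  conv_rhs => rw [Finset.sum_comm]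
  exact Finset.sum_congr rfl fun _ _ ↦ Finset.sum_comm

section Operators

variable {A ι : Type*} [CommRing A] [Algebra ℝ A] [Fintype ι]
  (d : ι → Derivation ℝ A A) (Γ : ι → ι → ι → A)

/-- The Ricci tensor `R_{ij} = R_{aij}^a`. -/
def ricci : Matrix ι ι A := Matrix.of fun i j ↦ ∑ a, curv d Γ a i j a

/-- The Hessian `∇_i ∇_j f`. -/
def hessian (f : A) : Matrix ι ι A := Matrix.of fun i j ↦ d i (d j f) - ∑ k, Γ k i j * d k f

/-- The scalar curvature. -/
def scalar (G : Matrix ι ι A) : A := ∑ i, ∑ j, G i j * ricci d Γ i j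

/-- The squared norm of the gradient. -/
def gradNormSq (G : Matrix ι ι A) (f : A) : A := ∑ i, ∑ j, G i j * d i f * d j f

/-- The rough Laplacian of a 2-tensor. -/
def laplacian (G h : Matrix ι ι A) : Matrix ι ι A :=
  Matrix.of fun i j ↦ ∑ a, ∑ b, G a b * nabla₃ d Γ (fun b i j ↦ covD d Γ b h i j) a b i j

/-- The covariant derivative of a 2-tensor in the direction of the gradient of `f`. -/
def nablaGrad (G : Matrix ι ι A) (f : A) (h : Matrix ι ι A) : Matrix ι ι A :=
  Matrix.of fun i j ↦ ∑ a, ∑ b, G a b * d b f * covD d Γ a h i j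

/-- The curvature action `Rm[h]_{ij} = g^{ac} g^{bd} R_{cidj} h_{ab}`. -/
def rmAction (g G h : Matrix ι ι A) : Matrix ι ι A :=
  Matrix.of fun i j ↦ ∑ a, ∑ b, ∑ c, ∑ e, G a c * G b e * (curv d Γ c i * g) j e * h a b

/-- The gradient of `f`, with components `g^{lm} ∂_m f`. -/
def grad (G : Matrix ι ι A) (f : A) : ι → A := G.mulVec fun m ↦ d m f

lemma hessian_row (f : A) (i : ι) : hessian d Γ f i
    = (fun j ↦ d i (d j f)) - (conn Γ i).mulVec fun k ↦ d k f := by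
  ext j; simp [hessian, Matrix.mulVec, dotProduct]

lemma laplacian_sub (G h h' : Matrix ι ι A) :
    laplacian d Γ G (h - h') = laplacian d Γ G h - laplacian d Γ G h' := by
  ext i j
  have e (a b : ι) := nabla₃_sub d Γ (fun b i j ↦ covD d Γ b h i j)
    (fun b i j ↦ covD d Γ b h' i j) a b i j
  simp only [laplacian, Matrix.of_apply, covD_sub, Matrix.sub_apply, Finset.sum_sub_distrib, e,
    mul_sub]

lemma nablaGrad_sub (G : Matrix ι ι A) (f : A) (h h' : Matrix ι ι A) :
    nablaGrad d Γ G f (h - h') = nablaGrad d Γ G f h - nablaGrad d Γ G f h' := by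
  ext i j
  simp only [nablaGrad, Matrix.of_apply, covD_sub, Matrix.sub_apply, mul_sub,
    Finset.sum_sub_distrib]

lemma rmAction_sub (g G h h' : Matrix ι ι A) :
    rmAction d Γ g G (h - h') = rmAction d Γ g G h - rmAction d Γ g G h' := by
  ext i j
  simp only [rmAction, Matrix.of_apply, Matrix.sub_apply, mul_sub, Finset.sum_sub_distrib]

lemma rmAction_smul (c : ℝ) (g G h : Matrix ι ι A) :
    rmAction d Γ g G (c • h) = c • rmAction d Γ g G h := by
  ext i j
  simp only [rmAction, Matrix.of_apply, Matrix.smul_apply, mul_smul_comm, Finset.smul_sum]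

lemma nablaGrad_eq (G : Matrix ι ι A) (f : A) (h : Matrix ι ι A) (i j : ι) :
    nablaGrad d Γ G f h i j = ∑ l, covD d Γ l h i j * grad d G f l := by
  simp only [nablaGrad, Matrix.of_apply, grad, Matrix.mulVec, dotProduct, Finset.mul_sum]
  exact Finset.sum_congr rfl fun _ _ ↦ Finset.sum_congr rfl fun _ _ ↦ by ring

variable {d Γ}

/-- Ricci identity for the differential of a function. -/
lemma covD_hessian_commutator (hd : ∀ i j φ, d i (d j φ) = d j (d i φ))
    (hΓ : ∀ k i j, Γ k i j = Γ k j i) (f : A) (a i j : ι) :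
    covD d Γ a (hessian d Γ f) i j
      = covD d Γ i (hessian d Γ f) a j - (curv d Γ a i).mulVec (fun l ↦ d l f) j := by
  have key (a i : ι) : (fun j ↦ covD d Γ a (hessian d Γ f) i j)
      = (fun j ↦ d a (d i (d j f))) - (dMat (d a) (conn Γ i)).mulVec (fun k ↦ d k f)
        - (conn Γ i).mulVec (fun k ↦ d a (d k f)) - (conn Γ a).mulVec (fun k ↦ d i (d k f))
        + (conn Γ a * conn Γ i).mulVec (fun k ↦ d k f)
        - fun j ↦ ∑ m, Γ m a i * hessian d Γ f m j := by
    have h1 : (fun j ↦ covD d Γ a (hessian d Γ f) i j) = (fun j ↦ d a (hessian d Γ f i j))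
        - (conn Γ a).mulVec (hessian d Γ f i) - fun j ↦ ∑ m, Γ m a i * hessian d Γ f m j := by
      ext j
      simp only [covD_apply, Finset.sum_add_distrib, Pi.sub_apply, Matrix.mulVec, dotProduct,
        conn_apply]
      ring
    have h2 : (fun j ↦ d a (hessian d Γ f i j)) = (fun j ↦ d a (d i (d j f)))
        - ((dMat (d a) (conn Γ i)).mulVec (fun k ↦ d k f)
          + (conn Γ i).mulVec (fun k ↦ d a (d k f))) := by
      rw [← derivation_mulVec]
      ext j
      rw [hessian_row]; simp
    rw [h1, h2, hessian_row, Matrix.mulVec_sub, Matrix.mulVec_mulVec]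
    abel
  have h := congrFun (key a i) j
  have h' := congrFun (key i a) j
  simp only [curv, Matrix.sub_mulVec, Pi.sub_apply, Pi.add_apply] at h h' ⊢
  rw [h, h', hd a i]
  simp only [hΓ _ a i]
  ring

lemma hessian_symm (hd : ∀ i j φ, d i (d j φ) = d j (d i φ))
    (hΓ : ∀ k i j, Γ k i j = Γ k j i) (f : A) (i j : ι) :
    hessian d Γ f i j = hessian d Γ f j i := by
  simp only [hessian, Matrix.of_apply, hd i j, hΓ _ i j]

lemma covD_symm {S : Matrix ι ι A} (hS : ∀ i j, S i j = S j i) (a i j : ι) :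
    covD d Γ a S i j = covD d Γ a S j i := by
  simp only [covD_apply, hS _ j, hS i, Finset.sum_add_distrib]
  ring

end Operators

namespace IsLeviCivita

variable {A ι : Type*} [CommRing A] [Algebra ℝ A] [Fintype ι] [DecidableEq ι]
  {d : ι → Derivation ℝ A A} {Γ : ι → ι → ι → A} {g G : Matrix ι ι A}
  (h : IsLeviCivita d Γ g G)
include h

lemma metric_mulVec_grad (f : A) : g.mulVec (grad d G f) = fun m ↦ d m f := by
  rw [grad, Matrix.mulVec_mulVec, h.inv', Matrix.one_mulVec]

/-- The covariant derivative of the gradient is the Hessian with one index raised. -/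
lemma derivation_grad (f : A) (i : ι) : (fun l ↦ d i (grad d G f l))
    = G.mulVec (hessian d Γ f i) - (conn Γ i).transpose.mulVec (grad d G f) := by
  unfold grad
  rw [derivation_mulVec, h.dMat_inv, hessian_row, Matrix.mulVec_sub, Matrix.sub_mulVec,
    Matrix.neg_mulVec, Matrix.mulVec_mulVec, Matrix.mulVec_mulVec]
  abel

lemma derivation_gradNormSq (f : A) (j : ι) :
    d j (gradNormSq d G f) = 2 * (hessian d Γ f).mulVec (grad d G f) j := by
  have h1 := h.derivation_trace j (Matrix.of fun a b ↦ d a f * d b f)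
  have h2 (a b : ι) : covD d Γ j (Matrix.of fun a b ↦ d a f * d b f) a b
      = hessian d Γ f j a * d b f + hessian d Γ f j b * d a f := by
    simp only [covD_apply, Matrix.of_apply, hessian, Derivation.leibniz, smul_eq_mul,
      Finset.sum_add_distrib, sub_mul, Finset.sum_mul]
    have e1 : ∑ m, Γ m j a * (d m f * d b f) = ∑ m, Γ m j a * d m f * d b f :=
      Finset.sum_congr rfl fun _ _ ↦ by ring
    have e2 : ∑ m, Γ m j b * (d a f * d m f) = ∑ m, Γ m j b * d m f * d a f :=
      Finset.sum_congr rfl fun _ _ ↦ by ring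
    rw [e1, e2]; ring
  simp only [h2, mul_add, Finset.sum_add_distrib, Matrix.of_apply, ← mul_assoc] at h1
  have e1 : ∑ a, ∑ b, G a b * hessian d Γ f j a * d b f
      = (hessian d Γ f).mulVec (grad d G f) j := by
    simp only [Matrix.mulVec, dotProduct, grad, Finset.mul_sum]
    exact Finset.sum_congr rfl fun _ _ ↦ Finset.sum_congr rfl fun _ _ ↦ by ring
  have e2 : ∑ a, ∑ b, G a b * hessian d Γ f j b * d a f
      = (hessian d Γ f).mulVec (grad d G f) j := by
    rw [← e1, Finset.sum_comm]
    simp only [h.inv_symm_apply]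
  rw [gradNormSq, h1, e1, e2, two_mul]

/-- Contraction of two indices commutes with the covariant derivative of a 3-tensor. -/
lemma trace_nabla₃ (T : ι → ι → ι → A) (i j : ι) :
    ∑ a, ∑ b, G a b * nabla₃ d Γ T i a b j
      = d i (∑ a, ∑ b, G a b * T a b j) - ∑ m, Γ m i j * ∑ a, ∑ b, G a b * T a b m := by
  have e := h.derivation_trace i (Matrix.of fun a b ↦ T a b j)
  simp only [Matrix.of_apply] at e
  have e2 : ∑ m, Γ m i j * ∑ a, ∑ b, G a b * T a b m
      = ∑ a, ∑ b, G a b * ∑ m, Γ m i j * T a b m := by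
    simp only [Finset.mul_sum]
    rw [Finset.sum_comm]
    refine Finset.sum_congr rfl fun a _ ↦ ?_
    rw [Finset.sum_comm]
    exact Finset.sum_congr rfl fun _ _ ↦ Finset.sum_congr rfl fun _ _ ↦ by ring
  rw [e, e2, ← Finset.sum_sub_distrib]
  refine Finset.sum_congr rfl fun a _ ↦ ?_
  rw [← Finset.sum_sub_distrib]
  refine Finset.sum_congr rfl fun b _ ↦ ?_
  simp only [nabla₃, covD_apply, Matrix.of_apply, Finset.sum_add_distrib]
  ring

/-- Contraction of the first and third index of the curvature tensor. -/
lemma trace_riem (i m : ι) :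
    ∑ a, ∑ b, G a b * (curv d Γ a i * g) b m = -ricci d Γ i m := by
  rw [ricci, Matrix.of_apply, h.ricci_eq_trace, ← Finset.sum_neg_distrib]
  refine Finset.sum_congr rfl fun a _ ↦ ?_
  rw [← Finset.sum_neg_distrib]
  exact Finset.sum_congr rfl fun b _ ↦ by rw [riem_skew_left]; ring

lemma trace_curv (i m : ι) :
    ∑ a, ∑ b, G a b * curv d Γ a i b m = -(ricci d Γ * G) i m := by
  have e (a b : ι) : curv d Γ a i b m = ∑ p, (curv d Γ a i * g) b p * G p m := by
    rw [← Matrix.mul_apply, mul_assoc, h.inv', mul_one]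
  rw [Matrix.mul_apply, ← Finset.sum_neg_distrib]
  simp only [e, ← neg_mul, ← h.trace_riem, Finset.mul_sum, Finset.sum_mul]
  rw [sum_rotate]
  simp only [mul_assoc]

lemma trace_curv_mulVec (i : ι) (w : ι → A) :
    ∑ a, ∑ b, G a b * (curv d Γ a i).mulVec w b = -(ricci d Γ).mulVec (G.mulVec w) i := by
  rw [Matrix.mulVec_mulVec]
  simp only [Matrix.mulVec, dotProduct, ← Finset.sum_neg_distrib, ← neg_mul, ← h.trace_curv,
    Finset.mul_sum, Finset.sum_mul]
  rw [sum_rotate]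
  simp only [mul_assoc]

lemma curv_mulVec (a i : ι) (w : ι → A) :
    (curv d Γ a i).mulVec w = (curv d Γ a i * g).mulVec (G.mulVec w) := by
  rw [Matrix.mulVec_mulVec, mul_assoc, h.inv', mul_one]

lemma ricci_symm (i j : ι) : ricci d Γ i j = ricci d Γ j i := by
  simp only [ricci, Matrix.of_apply, h.ricci_eq_trace]
  rw [Finset.sum_comm]
  refine Finset.sum_congr rfl fun a _ ↦ Finset.sum_congr rfl fun b _ ↦ ?_
  rw [h.inv_symm_apply, h.riem_pair_symm i, riem_skew_left a j, h.riem_skew_right j a, neg_neg]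

/-- The divergence of the Hessian: `∇^a ∇_a ∇_j f = ∇_j Δf + Rc(∇f)_j`. -/
lemma trace_covD_hessian (f : A) (j : ι) :
    ∑ a, ∑ b, G a b * covD d Γ a (hessian d Γ f) b j
      = d j (∑ a, ∑ b, G a b * hessian d Γ f a b) + (ricci d Γ).mulVec (grad d G f) j := by
  have e (a b : ι) : covD d Γ a (hessian d Γ f) b j = covD d Γ j (hessian d Γ f) a b
      - (curv d Γ a j).mulVec (fun l ↦ d l f) b := by
    rw [covD_symm (hessian_symm h.comm h.torsion f),
      covD_hessian_commutator h.comm h.torsion]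
  simp only [e, mul_sub, Finset.sum_sub_distrib]
  rw [h.trace_curv_mulVec, h.derivation_trace, grad]
  ring

/-- The curvature action in terms of contractions with curvature matrices. -/
lemma rmAction_eq (S : Matrix ι ι A) (i j : ι) : rmAction d Γ g G S i j
    = ∑ a, ∑ b, G a b * (curv d Γ b i * g).mulVec (G.mulVec (S a)) j := by
  simp only [rmAction, Matrix.of_apply, Matrix.mulVec, dotProduct, Finset.mul_sum]
  refine Finset.sum_congr rfl fun a _ ↦ ?_
  rw [← sum_rotate]
  refine Finset.sum_congr rfl fun b _ ↦ Finset.sum_congr rfl fun c _ ↦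
    Finset.sum_congr rfl fun e _ ↦ ?_
  rw [h.inv_symm_apply e c]; ring

/-- Commuting the derivatives in `∇^a ∇_i S_{aj}` produces `Rc ∘ S - Rm[S]`. -/
lemma trace_nabla₃_commutator (S : Matrix ι ι A) (i j : ι) :
    ∑ a, ∑ b, G a b * nabla₃ d Γ (fun a b j ↦ covD d Γ a S b j) a i b j
      = ∑ a, ∑ b, G a b * nabla₃ d Γ (fun a b j ↦ covD d Γ a S b j) i a b j
        + (ricci d Γ * G * S) i j - rmAction d Γ g G S i j := by
  have e (a b : ι) : nabla₃ d Γ (fun a b j ↦ covD d Γ a S b j) a i b j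
      = nabla₃ d Γ (fun a b j ↦ covD d Γ a S b j) i a b j
        - (curv d Γ a i).mulVec (fun m ↦ S m j) b - (curv d Γ a i).mulVec (S b) j := by
    have h1 := congrFun₂ (covD_commutator Γ h.comm a i S) b j
    have h2 : (curv d Γ a i * S) b j = (curv d Γ a i).mulVec (fun m ↦ S m j) b := rfl
    have h3 : (S * (curv d Γ a i).transpose) b j = (curv d Γ a i).mulVec (S b) j := by
      simp [Matrix.mul_apply, Matrix.mulVec, dotProduct, mul_comm]
    simp only [Matrix.sub_apply, Matrix.neg_apply, h2, h3] at h1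
    have h4 (a : ι) : (Matrix.of fun b j ↦ covD d Γ a S b j) = covD d Γ a S := rfl
    simp only [nabla₃_eq_covD, h.torsion _ i a, h4]
    linear_combination h1
  have e2 : ∑ a, ∑ b, G a b * (curv d Γ a i).mulVec (S b) j = rmAction d Γ g G S i j := by
    rw [h.rmAction_eq, Finset.sum_comm]
    refine Finset.sum_congr rfl fun a _ ↦ Finset.sum_congr rfl fun b _ ↦ ?_
    rw [h.inv_symm_apply, h.curv_mulVec]
  have e3 : (ricci d Γ * G * S) i j
      = (ricci d Γ).mulVec (G.mulVec fun m ↦ S m j) i := by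
    rw [Matrix.mulVec_mulVec]; rfl
  simp only [e, mul_sub, Finset.sum_sub_distrib]
  rw [h.trace_curv_mulVec, e2, e3]
  ring

/-- Contraction of the first and third index of a 4-tensor commutes with covariant
differentiation. -/
lemma trace_nabla₄ (Q : ι → ι → ι → ι → A) (l j i : ι) :
    ∑ a, ∑ b, G a b * nabla₄ d Γ Q l a j b i
      = covD d Γ l (Matrix.of fun j i ↦ ∑ a, ∑ b, G a b * Q a j b i) j i := by
  have e := h.derivation_trace l (Matrix.of fun a b ↦ Q a j b i)
  have e2 (φ : ι → A) (T : ι → ι → ι → A) : ∑ m, φ m * ∑ a, ∑ b, G a b * T m a b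
      = ∑ a, ∑ b, G a b * ∑ m, φ m * T m a b := by
    simp only [Finset.mul_sum]
    rw [← sum_rotate]
    exact Finset.sum_congr rfl fun _ _ ↦ Finset.sum_congr rfl fun _ _ ↦
      Finset.sum_congr rfl fun _ _ ↦ by ring
  simp only [Matrix.of_apply] at e
  simp only [covD_apply, Matrix.of_apply, e, Finset.sum_add_distrib, e2]
  simp only [← Finset.sum_add_distrib, ← Finset.sum_sub_distrib]
  refine Finset.sum_congr rfl fun a _ ↦ Finset.sum_congr rfl fun b _ ↦ ?_
  simp only [nabla₄, Finset.sum_add_distrib]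
  ring

/-- The contracted second Bianchi identity: the divergence of the curvature tensor is the
exterior derivative of the Ricci tensor. -/
lemma trace_nabla₄_riem (i j l : ι) :
    ∑ a, ∑ b, G a b * nabla₄ d Γ (fun a b ↦ curv d Γ a b * g) a b i j l
      = covD d Γ l (ricci d Γ) j i - covD d Γ j (ricci d Γ) l i := by
  have e (a b : ι) : nabla₄ d Γ (fun a b ↦ curv d Γ a b * g) a b i j l
      = nabla₄ d Γ (fun a b ↦ curv d Γ a b * g) j a l b i
        - nabla₄ d Γ (fun a b ↦ curv d Γ a b * g) l a j b i := by
    have h1 : nabla₄ d Γ (fun a b ↦ curv d Γ a b * g) a b i j l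
        = nabla₄ d Γ (fun a b ↦ curv d Γ a b * g) a j l b i := by
      simp only [nabla₄, h.riem_pair_symm j l, h.riem_pair_symm _ l, h.riem_pair_symm j _ b i,
        Finset.sum_add_distrib]
      ring
    have h2 : nabla₄ d Γ (fun a b ↦ curv d Γ a b * g) j l a b i
        = -nabla₄ d Γ (fun a b ↦ curv d Γ a b * g) j a l b i := by
      simp only [nabla₄, riem_skew_left (d := d) (Γ := Γ) (g := g) l,
        riem_skew_left (d := d) (Γ := Γ) (g := g) _ a, Finset.sum_add_distrib, map_neg, mul_neg,
        Finset.sum_neg_distrib]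
      ring
    linear_combination h1 + h.nabla₄_riem_cyclic a j l b i - h2
  have hR : (Matrix.of fun j i ↦ ∑ a, ∑ b, G a b * (curv d Γ a j * g) b i) = -ricci d Γ := by
    ext j i; exact h.trace_riem j i
  have hn (a : ι) : covD d Γ a (-ricci d Γ) = -covD d Γ a (ricci d Γ) := by
    rw [← zero_sub, covD_sub, ← zero_sub]
    congr 1
    ext; simp [covD_apply]
  have ht (l j i : ι) := h.trace_nabla₄ (fun a b ↦ curv d Γ a b * g) l j i
  simp only [hR, hn, Matrix.neg_apply] at ht
  simp only [e, mul_sub, Finset.sum_sub_distrib, ht]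
  ring

/-- Leibniz rule for the contraction of the curvature tensor with the gradient of `f`. -/
lemma nabla₃_riem_grad (f : A) (a b i j : ι) :
    nabla₃ d Γ (fun b i j ↦ (curv d Γ b i * g).mulVec (grad d G f) j) a b i j
      = ∑ l, nabla₄ d Γ (fun a b ↦ curv d Γ a b * g) a b i j l * grad d G f l
        + (curv d Γ b i * g).mulVec (G.mulVec (hessian d Γ f a)) j := by
  set u := grad d G f with hu
  have h1 := congrFun (derivation_mulVec (d a) (curv d Γ b i * g) u) j
  rw [hu, h.derivation_grad, ← hu, Matrix.mulVec_sub, Matrix.mulVec_mulVec u] at h1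
  have h2 : ∑ l, nabla₄ d Γ (fun a b ↦ curv d Γ a b * g) a b i j l * u l
      = (covD d Γ a (curv d Γ b i * g)).mulVec u j
        - ∑ m, (Γ m a b * (curv d Γ m i * g).mulVec u j
          + Γ m a i * (curv d Γ b m * g).mulVec u j) := by
    simp only [nabla₄_eq_covD, sub_mul, Finset.sum_sub_distrib, Matrix.mulVec, dotProduct,
      Finset.sum_mul, Finset.mul_sum, Finset.sum_add_distrib, add_mul]
    congr 2 <;> rw [Finset.sum_comm] <;> simp only [mul_assoc]
  have h3 : (conn Γ a * (curv d Γ b i * g)).mulVec u j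
      = ∑ m, Γ m a j * (curv d Γ b i * g).mulVec u m := by
    rw [← Matrix.mulVec_mulVec]; rfl
  rw [h2, covD, Matrix.sub_mulVec, Matrix.sub_mulVec, nabla₃]
  simp only [Pi.add_apply, Pi.sub_apply, Finset.sum_add_distrib, h3] at h1 ⊢
  linear_combination h1

/-- The weighted Lichnerowicz Laplacian annihilates the Hessian of the potential of a
normalized shrinker. -/
theorem lichnerowicz_hessian (f : A)
    (soliton : ricci d Γ + hessian d Γ f = (1 / 2 : ℝ) • g)
    (normalized : scalar d Γ G + gradNormSq d G f = f) :
    laplacian d Γ G (hessian d Γ f) - nablaGrad d Γ G f (hessian d Γ f)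
      + (2 : ℝ) • rmAction d Γ g G (hessian d Γ f) = 0 := by
  set H := hessian d Γ f with hH
  set u := grad d G f with hu
  have Hsymm : ∀ i j, H i j = H j i := hessian_symm h.comm h.torsion f
  have hric : ricci d Γ = (1 / 2 : ℝ) • g - H := eq_sub_of_add_eq soliton
  have hricD (a : ι) : covD d Γ a (ricci d Γ) = -covD d Γ a H := by
    rw [hric, covD_sub, covD_smul, h.covD_metric, smul_zero, zero_sub]
  -- the trace of the soliton equation, differentiated: `∇ Δf = -∇f + ∇|∇f|²`
  have htr (j : ι) : d j (∑ a, ∑ b, G a b * H a b) = -d j f + 2 * H.mulVec u j := by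
    have e1 : ∑ a, ∑ b, G a b * H a b = (1 / 2 : ℝ) • ∑ a, ∑ b, G a b * g a b - scalar d Γ G := by
      rw [scalar, hric]
      simp only [Matrix.sub_apply, Matrix.smul_apply, mul_sub, Finset.sum_sub_distrib,
        mul_smul_comm, Finset.smul_sum]
      ring
    rw [e1, eq_sub_of_add_eq normalized, map_sub, Derivation.map_smul, h.derivation_trace,
      h.covD_metric, map_sub, h.derivation_gradNormSq,
      ← hu, ← hH]
    simp only [Matrix.zero_apply, mul_zero, Finset.sum_const_zero, smul_zero]
    ring
  -- the divergence of the Hessian is `H(∇f) - ½ ∇f`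
  have hV (j : ι) : ∑ a, ∑ b, G a b * covD d Γ a H b j
      = (H.mulVec u - (1 / 2 : ℝ) • fun m ↦ d m f) j := by
    rw [h.trace_covD_hessian, htr, hric, Matrix.sub_mulVec, Matrix.smul_mulVec,
      h.metric_mulVec_grad]
    simp only [Pi.sub_apply, Pi.smul_apply]
    have : d j f = (1 / 2 : ℝ) • d j f + (1 / 2 : ℝ) • d j f := by rw [← add_smul]; norm_num
    linear_combination -this
  -- `∇_i` of the divergence of the Hessian
  have hDV (i j : ι) : ∑ a, ∑ b, G a b * nabla₃ d Γ (fun a b j ↦ covD d Γ a H b j) i a b j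
      = (covD d Γ i H).mulVec u j + (H * G * H) i j - (1 / 2 : ℝ) • H i j := by
    rw [h.trace_nabla₃]
    simp only [hV]
    have h1 := congrFun (derivation_mulVec (d i) H u) j
    rw [hu, h.derivation_grad, ← hu, Matrix.mulVec_sub, Matrix.mulVec_mulVec u,
      Matrix.mulVec_mulVec] at h1
    have h2 : (conn Γ i * H).mulVec u j = ∑ m, Γ m i j * H.mulVec u m := by
      rw [← Matrix.mulVec_mulVec]; rfl
    have h3 : (H * G).mulVec (H i) j = (H * G * H) i j := by
      have : (H * G * H).transpose = H * G * H := by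
        have : H.transpose = H := by ext i j; exact Hsymm j i
        rw [Matrix.transpose_mul, Matrix.transpose_mul, this, h.inv_symm, mul_assoc]
      rw [← this, Matrix.transpose_apply, Matrix.mul_apply]
      exact Finset.sum_congr rfl fun m _ ↦ by rw [Hsymm i m]
    have h4 : H i j = d i (d j f) - ∑ k, Γ k i j * d k f := rfl
    simp only [covD, Matrix.sub_mulVec, Pi.sub_apply, Pi.add_apply, Pi.smul_apply, map_sub,
      Derivation.map_smul, mul_sub, Finset.sum_sub_distrib, mul_smul_comm, ← Finset.smul_sum,
      h2, h3, ← hH] at h1 ⊢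
    rw [h1, h4, smul_sub]
    ring
  ext i j
  -- the Ricci identity inside the Laplacian
  have hlap : laplacian d Γ G H i j
      = ∑ a, ∑ b, G a b * nabla₃ d Γ (fun a b j ↦ covD d Γ a H b j) a i b j
        - ∑ a, ∑ b, G a b * nabla₃ d Γ (fun b i j ↦ (curv d Γ b i * g).mulVec u j) a b i j := by
    have e : (fun b i j ↦ covD d Γ b H i j)
        = fun b i j ↦ covD d Γ i H b j - (curv d Γ b i * g).mulVec u j := by
      funext b i j
      rw [hH, covD_hessian_commutator h.comm h.torsion, h.curv_mulVec]; rfl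
    have e2 (a b : ι) := nabla₃_sub d Γ (fun b i j ↦ covD d Γ i H b j)
      (fun b i j ↦ (curv d Γ b i * g).mulVec u j) a b i j
    have e3 (a b : ι) : nabla₃ d Γ (fun b i j ↦ covD d Γ i H b j) a b i j
        = nabla₃ d Γ (fun a b j ↦ covD d Γ a H b j) a i b j :=
      nabla₃_swap d Γ (fun b i j ↦ covD d Γ b H i j) a b i j
    have e4 (a b : ι) : nabla₃ d Γ (fun b i j ↦ covD d Γ b H i j) a b i j
        = nabla₃ d Γ (fun a b j ↦ covD d Γ a H b j) a i b j
          - nabla₃ d Γ (fun b i j ↦ (curv d Γ b i * g).mulVec u j) a b i j := by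
      rw [← e3, ← e2, ← e]
    simp only [laplacian, Matrix.of_apply, e4, ← Finset.sum_sub_distrib, ← mul_sub]
  -- the divergence of `R_{bij}^l ∂_l f`, by the contracted second Bianchi identity
  have hK : ∑ a, ∑ b, G a b * nabla₃ d Γ (fun b i j ↦ (curv d Γ b i * g).mulVec u j) a b i j
      = (covD d Γ j H).mulVec u i - nablaGrad d Γ G f H i j + rmAction d Γ g G H i j := by
    simp only [hu, h.nabla₃_riem_grad, mul_add, Finset.sum_add_distrib]
    rw [h.rmAction_eq, ← hu, ← hH, nablaGrad_eq, ← hu]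
    congr 1
    simp only [Finset.mul_sum]
    rw [sum_rotate]
    simp only [← mul_assoc, ← Finset.sum_mul, h.trace_nabla₄_riem, hricD, Matrix.neg_apply]
    rw [Matrix.mulVec, dotProduct, ← Finset.sum_sub_distrib]
    refine Finset.sum_congr rfl fun l _ ↦ ?_
    rw [covD_symm Hsymm j i l, covD_symm Hsymm l i j]; ring
  -- the skew part of `∇_i ∇_j ∇_l f` in `i, j` is annihilated by `∇^l f`
  have hskew : (covD d Γ i H).mulVec u j = (covD d Γ j H).mulVec u i := by
    have e (l : ι) : covD d Γ i H j l * u l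
        = covD d Γ j H i l * u l - u l * (curv d Γ i j * g).mulVec u l := by
      rw [hH, covD_hessian_commutator h.comm h.torsion, h.curv_mulVec]
      simp only [← hH]
      change (_ - (curv d Γ i j * g).mulVec u l) * _ = _
      ring
    have e0 : ∑ l, u l * (curv d Γ i j * g).mulVec u l = 0 := by
      refine eq_zero_of_eq_neg ?_
      simp only [Matrix.mulVec, dotProduct, Finset.mul_sum, ← Finset.sum_neg_distrib]
      rw [Finset.sum_comm]
      refine Finset.sum_congr rfl fun l _ ↦ Finset.sum_congr rfl fun m _ ↦ ?_
      rw [h.riem_skew_right]; ring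
    calc (covD d Γ i H).mulVec u j = ∑ l, covD d Γ i H j l * u l := rfl
      _ = ∑ l, covD d Γ j H i l * u l := by
        rw [Finset.sum_congr rfl fun l _ ↦ e l, Finset.sum_sub_distrib, e0, sub_zero]
      _ = (covD d Γ j H).mulVec u i := rfl
  have hRH : (ricci d Γ * G * H) i j = (1 / 2 : ℝ) • H i j - (H * G * H) i j := by
    rw [hric, sub_mul, sub_mul, Matrix.smul_mul, h.inv', Matrix.smul_mul, one_mul]; rfl
  rw [Matrix.add_apply, Matrix.sub_apply, Matrix.smul_apply, hlap, hK, h.trace_nabla₃_commutator,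
    hDV, hRH, hskew, two_smul, Matrix.zero_apply]
  ring

/-- The Ricci tensor of a normalized shrinker is an eigentensor of the weighted Lichnerowicz
Laplacian: this follows from the equation for the Hessian, since the metric is parallel and
`Rm[g] = Rc`. -/
theorem lichnerowicz_ricci (f : A)
    (soliton : ricci d Γ + hessian d Γ f = (1 / 2 : ℝ) • g)
    (normalized : scalar d Γ G + gradNormSq d G f = f) :
    laplacian d Γ G (ricci d Γ) - nablaGrad d Γ G f (ricci d Γ)
      + (2 : ℝ) • rmAction d Γ g G (ricci d Γ) = ricci d Γ := by
  have hD (a : ι) : covD d Γ a ((1 / 2 : ℝ) • g) = 0 := by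
    rw [covD_smul, h.covD_metric, smul_zero]
  have h1 : laplacian d Γ G ((1 / 2 : ℝ) • g) = 0 := by
    ext i j; simp only [laplacian, hD, nabla₃]; simp
  have h2 : nablaGrad d Γ G f ((1 / 2 : ℝ) • g) = 0 := by
    ext i j; simp only [nablaGrad, hD]; simp
  have h3 : rmAction d Γ g G g = ricci d Γ := by
    ext i j
    rw [h.rmAction_eq]
    have e (a : ι) : G.mulVec (g a) = Pi.single a 1 := by
      have : g a = g.mulVec (Pi.single a 1) := by
        ext m; simp [h.symm_apply]
      rw [this, Matrix.mulVec_mulVec, h.inv, Matrix.one_mulVec]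
    simp only [e]
    rw [ricci, Matrix.of_apply, h.ricci_eq_trace, Finset.sum_comm]
    refine Finset.sum_congr rfl fun a _ ↦ Finset.sum_congr rfl fun b _ ↦ ?_
    rw [Matrix.mulVec_single_one, Matrix.col_apply, h.riem_skew_right, riem_skew_left,
      h.inv_symm_apply]
    ring
  have key := h.lichnerowicz_hessian f soliton normalized
  rw [show hessian d Γ f = (1 / 2 : ℝ) • g - ricci d Γ from eq_sub_of_add_eq' soliton,
    laplacian_sub, nablaGrad_sub, rmAction_sub, rmAction_smul, h1, h2, h3, smul_sub, smul_smul] at key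
  norm_num at key
  rw [← sub_eq_zero, ← neg_eq_zero]
  rw [← key]; abel

end IsLeviCivita

end Shrinker.Formal

/-! ### Changes of coordinates -/

namespace Shrinker.Formal

section ChangeOfCoordinates

variable {A A' ι : Type*} [CommRing A] [Algebra ℝ A] [CommRing A'] [Algebra ℝ A'] [Fintype ι]

/-- The data of a change of coordinates: a substitution homomorphism `ψ` whose Jacobian matrix
`J`, with entries `J i a = ∂_i ψ^a`, satisfies the chain rule and the symmetry of second
derivatives. -/
structure IsCoordChange (d : ι → Derivation ℝ A A) (d' : ι → Derivation ℝ A' A')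
    (ψ : A' →ₐ[ℝ] A) (J : Matrix ι ι A) : Prop where
  chain : ∀ i φ, d i (ψ φ) = ∑ a, J i a * ψ (d' a φ)
  symm : ∀ i k a, d i (J k a) = d k (J i a)

/-- The pull-back of the connection matrices along a change of coordinates. -/
def pullConn (ψ : A' →ₐ[ℝ] A) (J : Matrix ι ι A) (Γ' : ι → ι → ι → A') (i : ι) : Matrix ι ι A :=
  ∑ b, J i b • (conn Γ' b).map ψ

/-- The chain rule for matrices. -/
lemma IsCoordChange.dMat_map {d : ι → Derivation ℝ A A} {d' : ι → Derivation ℝ A' A'}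
    {ψ : A' →ₐ[ℝ] A} {J : Matrix ι ι A} (c : IsCoordChange d d' ψ J) (i : ι) (S : Matrix ι ι A') :
    dMat (d i) (S.map ψ) = ∑ a, J i a • (dMat (d' a) S).map ψ := by
  ext k l
  simp [c.chain, Matrix.sum_apply]

variable [DecidableEq ι]

/-- A torsion-free connection compatible with the metric is the Levi-Civita connection. -/
lemma IsLeviCivita.unique {d : ι → Derivation ℝ A A} {Γ : ι → ι → ι → A} {g G : Matrix ι ι A}
    (h : IsLeviCivita d Γ g G) (B : ι → Matrix ι ι A) (hB : ∀ i k m, B i k m = B k i m)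
    (hg : ∀ i, dMat (d i) g = B i * g + g * (B i).transpose) (i : ι) : B i = conn Γ i := by
  set C : ι → Matrix ι ι A := fun i ↦ B i - conn Γ i with hC
  have sym (i k l : ι) : (C i * g) k l = (C k * g) i l := by
    simp only [hC, Matrix.mul_apply, Matrix.sub_apply, conn_apply, hB i k, h.torsion _ i k]
  have skew (i k l : ι) : (C i * g) k l = -(C i * g) l k := by
    have e : C i * g + (C i * g).transpose = 0 := by
      have e1 := hg i
      rw [h.compat] at e1
      rw [Matrix.transpose_mul, h.symm]
      simp only [hC, Matrix.transpose_sub]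
      calc _ = (B i * g + g * (B i).transpose)
            - (conn Γ i * g + g * (conn Γ i).transpose) := by noncomm_ring
        _ = 0 := by rw [e1, sub_self]
    have := congrFun₂ e k l
    exact eq_neg_of_add_eq_zero_left this
  -- a tensor symmetric in its first two and skew in its last two indices vanishes
  have zero (i : ι) : C i * g = 0 := by
    ext k l
    refine eq_zero_of_eq_neg ?_
    nth_rewrite 1 [sym i k l, skew k i l, sym k l i, skew l k i, sym l i k, skew i l k]
    ring
  have : C i = 0 := by
    calc C i = C i * g * G := by rw [mul_assoc, h.inv', mul_one]
      _ = 0 := by rw [zero, zero_mul]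
  exact sub_eq_zero.mp this

variable {d : ι → Derivation ℝ A A} {d' : ι → Derivation ℝ A' A'}
  {ψ : A' →ₐ[ℝ] A} {J K : Matrix ι ι A} (c : IsCoordChange d d' ψ J) (hK : K * J = 1)
  {Γ : ι → ι → ι → A} {Γ' : ι → ι → ι → A'} {g G : Matrix ι ι A} {g' G' : Matrix ι ι A'}
  (h : IsLeviCivita d Γ g G) (h' : IsLeviCivita d' Γ' g' G')
  (hg : g = J * g'.map ψ * J.transpose)
include c hK h h' hg

/-- The transformation law of the Christoffel symbols: a gauge transformation by the Jacobian. -/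
lemma conn_mul_jacobian (i : ι) :
    conn Γ i * J = dMat (d i) J + J * pullConn ψ J Γ' i := by
  have hg' (i : ι) : dMat (d i) (g'.map ψ) = pullConn ψ J Γ' i * g'.map ψ
      + g'.map ψ * (pullConn ψ J Γ' i).transpose := by
    rw [c.dMat_map, pullConn, Matrix.transpose_sum, Finset.sum_mul, Finset.mul_sum,
      ← Finset.sum_add_distrib]
    refine Finset.sum_congr rfl fun a _ ↦ ?_
    rw [h'.compat, Matrix.transpose_smul, Matrix.smul_mul, Matrix.mul_smul, ← smul_add]
    congr 1
    ext k l
    simp [Matrix.mul_apply]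
  rw [← h.unique (fun i ↦ (dMat (d i) J + J * pullConn ψ J Γ' i) * K) ?_ ?_ i, mul_assoc, hK,
    mul_one]
  · intro i k m
    simp only [Matrix.mul_apply]
    refine Finset.sum_congr rfl fun a _ ↦ ?_
    congr 1
    rw [Matrix.add_apply, Matrix.add_apply, dMat_apply, dMat_apply, c.symm i k]
    congr 1
    simp only [Matrix.mul_apply, pullConn, Matrix.sum_apply, Matrix.smul_apply, Matrix.map_apply,
      conn_apply, Finset.mul_sum, smul_eq_mul]
    rw [Finset.sum_comm]
    refine Finset.sum_congr rfl fun b _ ↦ Finset.sum_congr rfl fun e _ ↦ ?_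
    rw [h'.torsion a b e]; ring
  · intro i
    have e : (dMat (d i) J + J * pullConn ψ J Γ' i) * K * g
        = (dMat (d i) J + J * pullConn ψ J Γ' i) * g'.map ψ * J.transpose := by
      rw [hg]
      simp only [← mul_assoc]
      rw [mul_assoc _ K J, hK, mul_one]
    have e2 : g * ((dMat (d i) J + J * pullConn ψ J Γ' i) * K).transpose
        = J * g'.map ψ * (dMat (d i) J + J * pullConn ψ J Γ' i).transpose := by
      have hs : (g'.map ψ).transpose = g'.map ψ := by
        rw [← Matrix.transpose_map, h'.symm]
      have := congrArg Matrix.transpose e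
      simpa only [Matrix.transpose_mul _ g, Matrix.transpose_mul _ J.transpose,
        Matrix.transpose_mul _ (g'.map ψ), h.symm, hs, Matrix.transpose_transpose, ← mul_assoc]
        using this
    rw [e, e2, hg, dMat_mul, dMat_mul, hg', dMat_transpose, Matrix.transpose_add,
      Matrix.transpose_mul]
    noncomm_ring

/-- The transformation law of the curvature. -/
lemma curv_mul_jacobian (i j : ι) : curv d Γ i j * J
    = J * ∑ a, ∑ b, (J i a * J j b) • (curv d' Γ' a b).map ψ := by
  set P := pullConn ψ J Γ' with hP
  have hB := conn_mul_jacobian c hK h h' hg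
  have hd (i j : ι) : dMat (d i) (conn Γ j) * J = dMat (d i) (dMat (d j) J) + dMat (d i) J * P j
      + J * dMat (d i) (P j) - conn Γ j * dMat (d i) J := by
    have := congrArg (dMat (d i)) (hB j)
    rw [dMat_mul, dMat_add, dMat_mul] at this
    rw [eq_sub_of_add_eq this]; abel
  have hBB (i j : ι) : conn Γ i * conn Γ j * J
      = conn Γ i * dMat (d j) J + dMat (d i) J * P j + J * P i * P j := by
    rw [mul_assoc, hB, mul_add, ← mul_assoc, hB, add_mul]; abel
  -- the second derivatives of `J` and the mixed terms cancel by skew-symmetry in `i, j`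
  have hcurv : curv d Γ i j * J
      = J * (dMat (d i) (P j) - dMat (d j) (P i) - (P i * P j - P j * P i)) := by
    rw [curv, sub_mul, sub_mul, sub_mul, hd, hd, hBB, hBB, dMat_comm (h.comm i j)]
    noncomm_ring
  rw [hcurv]
  congr 1
  have hdP (i j : ι) : dMat (d i) (P j) = ∑ b, d i (J j b) • (conn Γ' b).map ψ
      + ∑ a, ∑ b, (J i a * J j b) • (dMat (d' a) (conn Γ' b)).map ψ := by
    rw [Finset.sum_comm, ← Finset.sum_add_distrib]
    ext k l
    simp only [hP, pullConn, dMat_apply, Matrix.sum_apply, Matrix.smul_apply, Matrix.add_apply,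
      map_sum, smul_eq_mul, Derivation.leibniz, Matrix.map_apply, c.chain, Finset.mul_sum]
    refine Finset.sum_congr rfl fun b _ ↦ ?_
    rw [add_comm, mul_comm]
    congr 1
    exact Finset.sum_congr rfl fun a _ ↦ by ring
  have hPP (i j : ι) : P i * P j = ∑ a, ∑ b, (J i a * J j b) • (conn Γ' a * conn Γ' b).map ψ := by
    simp only [hP, pullConn, Finset.sum_mul, Finset.mul_sum]
    rw [Finset.sum_comm]
    refine Finset.sum_congr rfl fun a _ ↦ Finset.sum_congr rfl fun b _ ↦ ?_
    rw [Matrix.smul_mul, Matrix.mul_smul, smul_smul, Matrix.map_mul]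
  have swap (F : ι → ι → Matrix ι ι A) : ∑ a, ∑ b, (J j a * J i b) • F a b
      = ∑ a, ∑ b, (J i a * J j b) • F b a := by
    rw [Finset.sum_comm]
    simp only [mul_comm]
  rw [hdP, hdP, hPP, hPP, swap, swap]
  simp only [c.symm j i]
  rw [add_sub_add_left_eq_sub]
  simp only [← Finset.sum_sub_distrib, ← smul_sub]
  refine Finset.sum_congr rfl fun a _ ↦ Finset.sum_congr rfl fun b _ ↦ ?_
  congr 1
  ext k l
  simp [curv, Matrix.mul_apply]

/-- The Ricci tensor is a tensor. -/
theorem ricci_coordChange : ricci d Γ = J * (ricci d' Γ').map ψ * J.transpose := by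
  have hJK : J * K = 1 := mul_eq_one_comm.mp hK
  ext i j
  have e (a : ι) : curv d Γ a i j a = ∑ q, ∑ b,
      (∑ e, ∑ p, J i e * (J j p * ψ (curv d' Γ' b e p q))) * (K q a * J a b) := by
    have h1 : curv d Γ a i
        = J * (∑ b, ∑ e, (J a b * J i e) • (curv d' Γ' b e).map ψ) * K := by
      rw [← curv_mul_jacobian c hK h h' hg, mul_assoc, hJK, mul_one]
    rw [h1]
    simp only [Finset.mul_sum, Finset.sum_mul, Matrix.sum_apply, Matrix.mul_smul,
      Matrix.smul_apply, Matrix.mul_apply, smul_eq_mul, Matrix.map_apply]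
    refine Finset.sum_congr rfl fun _ _ ↦ Finset.sum_congr rfl fun _ _ ↦
      Finset.sum_congr rfl fun _ _ ↦ Finset.sum_congr rfl fun _ _ ↦ by ring
  have hKJ (q b : ι) : ∑ a, K q a * J a b = (1 : Matrix ι ι A) q b := by
    rw [← hK, Matrix.mul_apply]
  rw [ricci, Matrix.of_apply]
  simp only [e]
  rw [← sum_rotate]
  simp only [← Finset.mul_sum, hKJ, Matrix.one_apply, mul_ite, mul_one, mul_zero,
    Finset.sum_ite_eq, Finset.mem_univ, if_true]
  simp only [Matrix.mul_apply, Matrix.map_apply, Matrix.transpose_apply, ricci, Matrix.of_apply,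
    map_sum, Finset.mul_sum, Finset.sum_mul]
  rw [sum_rotate]
  refine Finset.sum_congr rfl fun _ _ ↦ ?_
  rw [Finset.sum_comm]
  refine Finset.sum_congr rfl fun _ _ ↦ Finset.sum_congr rfl fun _ _ ↦ by ring

/-- The Hessian is a tensor. -/
theorem hessian_coordChange (φ : A') :
    hessian d Γ (ψ φ) = J * (hessian d' Γ' φ).map ψ * J.transpose := by
  set w : ι → A := fun a ↦ ψ (d' a φ)
  have hdf : (fun k ↦ d k (ψ φ)) = J.mulVec w := by
    ext k; rw [c.chain]; rfl
  ext i j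
  have h1 := congrFun (derivation_mulVec (d i) J w) j
  have h2 := congrFun (congrArg (fun S ↦ S.mulVec w) (conn_mul_jacobian c hK h h' hg i)) j
  have h3 : hessian d Γ (ψ φ) i j = d i (J.mulVec w j) - (conn Γ i * J).mulVec w j := by
    rw [← Matrix.mulVec_mulVec, ← hdf]; rfl
  rw [Matrix.add_mulVec, Pi.add_apply] at h2
  rw [h3, h1, h2, Pi.add_apply, add_sub_add_left_eq_sub, ← Matrix.mulVec_mulVec, ← Pi.sub_apply,
    ← Matrix.mulVec_sub]
  have h4 : (fun k ↦ d i (w k)) - (pullConn ψ J Γ' i).mulVec w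
      = fun k ↦ ∑ a, J i a * ψ (hessian d' Γ' φ a k) := by
    ext k
    simp only [w, c.chain, Pi.sub_apply, pullConn, Matrix.mulVec, dotProduct, Matrix.sum_apply,
      Matrix.smul_apply, Matrix.map_apply, conn_apply, smul_eq_mul, Finset.sum_mul, hessian,
      Matrix.of_apply, map_sub, map_sum, map_mul, mul_sub, Finset.sum_sub_distrib, Finset.mul_sum]
    rw [Finset.sum_comm (f := fun x y ↦ J i y * ψ (Γ' x y k) * ψ (d' x φ))]
    congr 1
    exact Finset.sum_congr rfl fun _ _ ↦ Finset.sum_congr rfl fun _ _ ↦ by ring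
  rw [h4]
  simp only [Matrix.mulVec, dotProduct, Matrix.mul_apply, Matrix.map_apply,
    Matrix.transpose_apply, Finset.sum_mul, Finset.mul_sum]
  refine Finset.sum_congr rfl fun _ _ ↦ Finset.sum_congr rfl fun _ _ ↦ by ring

end ChangeOfCoordinates

end Shrinker.Formal

/-! ### Smooth functions in one coordinate system -/

noncomputable section

namespace Shrinker.Local

open TopologicalSpace (Opens)

variable {n : ℕ} {U : Opens (Coord n)} {F F' : Coord n → ℝ} {y : Coord n}

section PartialDerivatives

lemma pd_congr (h : ∀ z ∈ U, F z = F' z) (i : Fin n) (hy : y ∈ U) : pd i F y = pd i F' y := by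
  have : F =ᶠ[nhds y] F' := by
    filter_upwards [U.isOpen.mem_nhds hy] with z hz using h z hz
  rw [pd, pd, this.fderiv_eq]

lemma differentiableAt_of_contDiffOn (h : ContDiffOn ℝ ∞ F U) (hy : y ∈ U) :
    DifferentiableAt ℝ F y :=
  (h.contDiffAt (U.isOpen.mem_nhds hy)).differentiableAt (by simp)

lemma contDiffOn_pd (h : ContDiffOn ℝ ∞ F U) (i : Fin n) : ContDiffOn ℝ ∞ (pd i F) U :=
  (h.fderiv_of_isOpen U.isOpen (by simp)).clm_apply contDiffOn_const

lemma pd_add (h : DifferentiableAt ℝ F y) (h' : DifferentiableAt ℝ F' y) (i : Fin n) :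
    pd i (F + F') y = pd i F y + pd i F' y := by
  simp [pd, fderiv_add h h']

lemma pd_mul (h : DifferentiableAt ℝ F y) (h' : DifferentiableAt ℝ F' y) (i : Fin n) :
    pd i (F * F') y = F y * pd i F' y + F' y * pd i F y := by
  simp [pd, fderiv_mul h h']

lemma pd_const_smul (c : ℝ) (h : DifferentiableAt ℝ F y) (i : Fin n) :
    pd i (c • F) y = c * pd i F y := by
  rw [pd, fderiv_const_smul h]; rfl

lemma pd_comm (h : ContDiffOn ℝ ∞ F U) (hy : y ∈ U) (i j : Fin n) :
    pd i (pd j F) y = pd j (pd i F) y := by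
  have hF := h.contDiffAt (U.isOpen.mem_nhds hy)
  have hd : DifferentiableAt ℝ (fderiv ℝ F) y :=
    (hF.fderiv_right (m := 1) (by norm_cast)).differentiableAt (by simp)
  have e (i j : Fin n) : pd i (pd j F) y
      = fderiv ℝ (fderiv ℝ F) y (EuclideanSpace.single i 1) (EuclideanSpace.single j 1) := by
    have : pd j F = fun z ↦ fderiv ℝ F z (EuclideanSpace.single j 1) := rfl
    rw [this, pd, fderiv_clm_apply hd (differentiableAt_const _)]
    simp
  rw [e, e]
  exact (hF.isSymmSndFDerivAt (by simp; norm_cast)).eq _ _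

end PartialDerivatives

section SmoothFunctions

variable (U) in
/-- The algebra of smooth functions on an open subset `U` of the coordinate space. Its elements are
functions on the subtype `U`, so that values outside `U` play no role. -/
def smoothFn : Subalgebra ℝ (U → ℝ) where
  carrier := {φ | ∃ F : Coord n → ℝ, ContDiffOn ℝ ∞ F U ∧ ∀ y : U, F y = φ y}
  mul_mem' := by
    rintro _ _ ⟨F, hF, hF'⟩ ⟨H, hH, hH'⟩
    exact ⟨F * H, hF.mul hH, fun y ↦ by simp [hF', hH']⟩
  add_mem' := by
    rintro _ _ ⟨F, hF, hF'⟩ ⟨H, hH, hH'⟩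
    exact ⟨F + H, hF.add hH, fun y ↦ by simp [hF', hH']⟩
  algebraMap_mem' c := ⟨fun _ ↦ c, contDiffOn_const, fun _ ↦ rfl⟩

/-- Evaluation of a smooth function at a point. -/
def ev (y : U) : smoothFn U →ₐ[ℝ] ℝ := (Pi.evalAlgHom ℝ (fun _ ↦ ℝ) y).comp (smoothFn U).val

lemma smoothFn_ext {φ φ' : smoothFn U} (h : ∀ y, ev y φ = ev y φ') : φ = φ' :=
  Subtype.ext (funext h)

lemma ev_one_apply (y : U) (i j : Fin n) :
    ev y ((1 : Matrix (Fin n) (Fin n) (smoothFn U)) i j) = (1 : Matrix (Fin n) (Fin n) ℝ) i j := by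
  rw [Matrix.one_apply, Matrix.one_apply]
  split_ifs
  · exact map_one _
  · exact map_zero _

/-- The smooth function on `U` given by a function on the coordinate space. -/
def toSmooth (F : Coord n → ℝ) (hF : ContDiffOn ℝ ∞ F U) : smoothFn U :=
  ⟨fun y ↦ F y, F, hF, fun _ ↦ rfl⟩

@[simp] lemma ev_toSmooth (hF : ContDiffOn ℝ ∞ F U) (y : U) : ev y (toSmooth F hF) = F y := rfl

/-- `F` restricts to the smooth function `φ` on `U`. -/
def Rep (F : Coord n → ℝ) (φ : smoothFn U) : Prop := ∀ y : U, F y = ev y φ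

lemma Rep.contDiffOn {φ : smoothFn U} (h : Rep F φ) : ContDiffOn ℝ ∞ F U := by
  obtain ⟨F', hF', e⟩ := φ.2
  exact hF'.congr fun z hz ↦ (h ⟨z, hz⟩).trans (e ⟨z, hz⟩).symm

lemma rep_toSmooth (hF : ContDiffOn ℝ ∞ F U) : Rep F (toSmooth F hF) := fun _ ↦ rfl

/-- A function on the coordinate space that is smooth on `U` and restricts to `φ`. -/
def lift (φ : smoothFn U) : Coord n → ℝ := φ.2.choose

lemma contDiffOn_lift (φ : smoothFn U) : ContDiffOn ℝ ∞ (lift φ) U := φ.2.choose_spec.1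

lemma rep_lift (φ : smoothFn U) : Rep (lift φ) φ := φ.2.choose_spec.2

lemma differentiableAt_lift (φ : smoothFn U) (y : U) : DifferentiableAt ℝ (lift φ) y :=
  differentiableAt_of_contDiffOn (contDiffOn_lift φ) y.2

lemma Rep.pd_eq {φ : smoothFn U} (h : Rep F φ) (h' : Rep F' φ) (i : Fin n) (y : U) :
    pd i F y = pd i F' y :=
  pd_congr (fun z hz ↦ (h ⟨z, hz⟩).trans (h' ⟨z, hz⟩).symm) i y.2

variable (U) in
/-- The partial derivative `∂_i` as a derivation of the algebra of smooth functions. -/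
def pdDer (i : Fin n) : Derivation ℝ (smoothFn U) (smoothFn U) :=
  Derivation.mk'
    { toFun := fun φ ↦ toSmooth (pd i (lift φ)) (contDiffOn_pd (contDiffOn_lift φ) i)
      map_add' := fun φ φ' ↦ smoothFn_ext fun y ↦ by
        rw [map_add, ev_toSmooth, ev_toSmooth, ev_toSmooth,
          ← pd_add (differentiableAt_lift φ y) (differentiableAt_lift φ' y)]
        refine (rep_lift _).pd_eq (fun z ↦ ?_) i y
        rw [Pi.add_apply, rep_lift φ, rep_lift φ', map_add]
      map_smul' := fun c φ ↦ smoothFn_ext fun y ↦ by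
        rw [RingHom.id_apply, map_smul, ev_toSmooth, ev_toSmooth, smul_eq_mul,
          ← pd_const_smul c (differentiableAt_lift φ y)]
        refine (rep_lift _).pd_eq (fun z ↦ ?_) i y
        rw [Pi.smul_apply, rep_lift φ, map_smul] }
    fun φ φ' ↦ smoothFn_ext fun y ↦ by
      simp only [LinearMap.coe_mk, AddHom.coe_mk, smul_eq_mul, map_add, map_mul, ev_toSmooth]
      rw [← rep_lift φ, ← rep_lift φ',
        ← pd_mul (differentiableAt_lift φ y) (differentiableAt_lift φ' y)]
      refine (rep_lift _).pd_eq (fun z ↦ ?_) i y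
      rw [Pi.mul_apply, rep_lift φ, rep_lift φ', map_mul]

lemma Rep.pd {φ : smoothFn U} (h : Rep F φ) (i : Fin n) : Rep (pd i F) (pdDer U i φ) :=
  fun y ↦ h.pd_eq (rep_lift φ) i y

lemma pdDer_comm (i j : Fin n) (φ : smoothFn U) :
    pdDer U i (pdDer U j φ) = pdDer U j (pdDer U i φ) :=
  smoothFn_ext fun y ↦ by
    rw [← ((rep_lift φ).pd j).pd i y, ← ((rep_lift φ).pd i).pd j y,
      pd_comm (contDiffOn_lift φ) y.2]

lemma contDiffOn_det {S : Coord n → Matrix (Fin n) (Fin n) ℝ}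
    (hS : ∀ i j, ContDiffOn ℝ ∞ (fun y ↦ S y i j) U) :
    ContDiffOn ℝ ∞ (fun y ↦ (S y).det) U := by
  simp only [Matrix.det_apply]
  exact ContDiffOn.sum fun σ _ ↦ (contDiffOn_prod fun i _ ↦ hS _ _).const_smul _

lemma contDiffOn_inv {S : Coord n → Matrix (Fin n) (Fin n) ℝ}
    (hS : ∀ i j, ContDiffOn ℝ ∞ (fun y ↦ S y i j) U) (hdet : ∀ y ∈ U, (S y).det ≠ 0)
    (i j : Fin n) : ContDiffOn ℝ ∞ (fun y ↦ (S y)⁻¹ i j) U := by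
  have e (y : Coord n) : (S y)⁻¹ i j
      = ((S y).det)⁻¹ * ((S y).updateRow j (Pi.single i 1)).det := by
    rw [Matrix.inv_def, Matrix.smul_apply, Matrix.adjugate_apply, Ring.inverse_eq_inv', smul_eq_mul]
  simp only [e]
  refine ((contDiffOn_det hS).inv hdet).mul (contDiffOn_det fun k l ↦ ?_)
  by_cases hk : k = j
  · subst hk
    simpa using contDiffOn_const
  · simpa [Matrix.updateRow_ne hk] using hS k l

end SmoothFunctions

section Transfer

variable {g : Coord n → Matrix (Fin n) (Fin n) ℝ}

variable (U g) in
/-- `g` is a smooth nondegenerate symmetric bilinear form on `U`. -/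
structure IsMetricOn : Prop where
  smooth : ∀ i j, ContDiffOn ℝ ∞ (fun y ↦ g y i j) U
  symm : ∀ y ∈ U, ∀ i j, g y i j = g y j i
  nondeg : ∀ y ∈ U, (g y).det ≠ 0

namespace IsMetricOn

variable (hg : IsMetricOn U g)
include hg

lemma inv_mul (hy : y ∈ U) : (g y)⁻¹ * g y = 1 :=
  Matrix.nonsing_inv_mul _ (isUnit_iff_ne_zero.mpr (hg.nondeg y hy))

lemma contDiffOn_christoffel (k i j : Fin n) : ContDiffOn ℝ ∞ (christoffel g k i j) U := by
  refine contDiffOn_const.mul (ContDiffOn.sum fun l _ ↦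
    (contDiffOn_inv hg.smooth hg.nondeg k l).mul ?_)
  exact ((contDiffOn_pd (hg.smooth _ _) _).add (contDiffOn_pd (hg.smooth _ _) _)).sub
    (contDiffOn_pd (hg.smooth _ _) _)

lemma pd_symm (i k l : Fin n) (hy : y ∈ U) :
    pd i (fun z ↦ g z k l) y = pd i (fun z ↦ g z l k) y :=
  pd_congr (fun z hz ↦ hg.symm z hz k l) i hy

/-- The Christoffel symbols of the first kind. -/
lemma christoffel_mul (i k l : Fin n) (hy : y ∈ U) : ∑ m, christoffel g m i k y * g y m l
    = (1 / 2 : ℝ) * (pd i (fun z ↦ g z k l) y + pd k (fun z ↦ g z i l) y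
      - pd l (fun z ↦ g z i k) y) := by
  have hinv (p : Fin n) : ∑ m, (g y)⁻¹ m p * g y m l = (1 : Matrix (Fin n) (Fin n) ℝ) p l := by
    have hT : (g y).transpose = g y := by ext i j; exact hg.symm y hy j i
    have : ((g y)⁻¹).transpose * g y = 1 := by
      rw [Matrix.transpose_nonsing_inv, hT, hg.inv_mul hy]
    rw [← this, Matrix.mul_apply]; rfl
  simp only [christoffel, Finset.mul_sum, Finset.sum_mul]
  rw [Finset.sum_comm]
  have e (p : Fin n) (X : ℝ) : ∑ m, 1 / 2 * ((g y)⁻¹ m p * X) * g y m l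
      = if p = l then 1 / 2 * X else 0 := by
    have : ∑ m, 1 / 2 * ((g y)⁻¹ m p * X) * g y m l
        = 1 / 2 * X * ∑ m, (g y)⁻¹ m p * g y m l := by
      rw [Finset.mul_sum]
      exact Finset.sum_congr rfl fun _ _ ↦ by ring
    rw [this, hinv, Matrix.one_apply]; simp
  simp only [e]
  simp

/-- The components of the metric as elements of the algebra of smooth functions. -/
def gA : Matrix (Fin n) (Fin n) (smoothFn U) := Matrix.of fun i j ↦ toSmooth _ (hg.smooth i j)

/-- The components of the inverse metric as elements of the algebra of smooth functions. -/
def invA : Matrix (Fin n) (Fin n) (smoothFn U) :=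
  Matrix.of fun i j ↦ toSmooth _ (contDiffOn_inv hg.smooth hg.nondeg i j)

/-- The Christoffel symbols as elements of the algebra of smooth functions. -/
def chrA (k i j : Fin n) : smoothFn U := toSmooth _ (hg.contDiffOn_christoffel k i j)

lemma rep_metric (i j : Fin n) : Rep (fun y ↦ g y i j) (hg.gA i j) := fun _ ↦ rfl

lemma rep_inv (i j : Fin n) : Rep (fun y ↦ (g y)⁻¹ i j) (hg.invA i j) := fun _ ↦ rfl

lemma rep_christoffel (k i j : Fin n) : Rep (christoffel g k i j) (hg.chrA k i j) := fun _ ↦ rfl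

/-- The Christoffel symbols are those of the Levi-Civita connection. -/
lemma isLeviCivita : Formal.IsLeviCivita (pdDer U) hg.chrA hg.gA hg.invA where
  comm := pdDer_comm
  symm := by
    refine Matrix.ext fun i j ↦ smoothFn_ext fun y ↦ ?_
    exact hg.symm y y.2 j i
  inv := by
    refine Matrix.ext fun i j ↦ smoothFn_ext fun y ↦ ?_
    rw [Matrix.mul_apply, map_sum]
    simp only [map_mul, ← hg.rep_metric _ _ y, ← hg.rep_inv _ _ y]
    rw [← Matrix.mul_apply, hg.inv_mul y.2]
    exact (ev_one_apply y i j).symm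
  torsion k i j := smoothFn_ext fun y ↦ by
    rw [← hg.rep_christoffel k i j y, ← hg.rep_christoffel k j i y]
    simp only [christoffel, hg.pd_symm _ i j y.2]
    congr 1
    exact Finset.sum_congr rfl fun _ _ ↦ by ring
  compat i := by
    refine Matrix.ext fun k l ↦ smoothFn_ext fun y ↦ ?_
    simp only [Formal.dMat_apply, Matrix.add_apply, Matrix.mul_apply, Matrix.transpose_apply,
      Formal.conn_apply, map_add, map_sum, map_mul, ← (hg.rep_metric k l).pd i y,
      ← hg.rep_metric _ _ y, ← hg.rep_christoffel _ _ _ y]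
    have e : ∑ m, g y k m * christoffel g m i l y = ∑ m, christoffel g m i l y * g y m k :=
      Finset.sum_congr rfl fun m _ ↦ by rw [hg.symm y y.2 k m, mul_comm]
    rw [e, hg.christoffel_mul _ _ _ y.2, hg.christoffel_mul _ _ _ y.2, hg.pd_symm i l k y.2,
      hg.pd_symm l i k y.2, hg.pd_symm k i l y.2, hg.pd_symm k l i y.2]
    ring

lemma rep_riemannUp (i j k l : Fin n) :
    Rep (riemannUp g i j k l) (Formal.curv (pdDer U) hg.chrA i j k l) := fun y ↦ by
  simp only [riemannUp, Formal.curv_apply, map_add, map_sub, map_sum, map_mul,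
    ← (hg.rep_christoffel _ _ _).pd _ y, ← hg.rep_christoffel _ _ _ y]

lemma rep_ricci (i j : Fin n) :
    Rep (fun y ↦ ricci g y i j) (Formal.ricci (pdDer U) hg.chrA i j) := fun y ↦ by
  simp only [ricci, Formal.ricci, Matrix.of_apply, map_sum, ← hg.rep_riemannUp _ _ _ _ y]

lemma rep_riemann (i j k l : Fin n) : Rep (riemann g i j k l)
    ((Formal.curv (pdDer U) hg.chrA i j * hg.gA) l k) := fun y ↦ by
  simp only [riemann, Matrix.mul_apply, map_sum, map_mul, ← hg.rep_riemannUp _ _ _ _ y,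
    ← hg.rep_metric _ _ y]
  exact Finset.sum_congr rfl fun m _ ↦ by rw [hg.symm y y.2 k m, mul_comm]

lemma rep_scalar : Rep (scalar g) (Formal.scalar (pdDer U) hg.chrA hg.invA) := fun y ↦ by
  simp only [scalar, Formal.scalar, map_sum, map_mul, ← hg.rep_inv _ _ y, ← hg.rep_ricci _ _ y]

lemma rep_gradNormSq {f : Coord n → ℝ} {φ : smoothFn U} (hf : Rep f φ) :
    Rep (gradNormSq g f) (Formal.gradNormSq (pdDer U) hg.invA φ) := fun y ↦ by
  simp only [gradNormSq, Formal.gradNormSq, map_sum, map_mul, ← hg.rep_inv _ _ y, ← hf.pd _ y]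

lemma rep_hessian {f : Coord n → ℝ} {φ : smoothFn U} (hf : Rep f φ) (i j : Fin n) :
    Rep (fun y ↦ hessian g f y i j) (Formal.hessian (pdDer U) hg.chrA φ i j) := fun y ↦ by
  simp only [hessian, Formal.hessian, Matrix.of_apply, map_sub, map_sum, map_mul,
    ← (hf.pd _).pd _ y, ← hf.pd _ y, ← hg.rep_christoffel _ _ _ y]

variable {h : Coord n → Matrix (Fin n) (Fin n) ℝ} {hA : Matrix (Fin n) (Fin n) (smoothFn U)}
  (hh : ∀ i j, Rep (fun y ↦ h y i j) (hA i j))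
include hh

lemma rep_nabla₂ (a i j : Fin n) :
    Rep (nabla₂ g h a i j) (Formal.covD (pdDer U) hg.chrA a hA i j) := fun y ↦ by
  simp only [nabla₂, Formal.covD_apply, map_sub, map_sum, map_add, map_mul, ← (hh _ _).pd _ y,
    ← hh _ _ y, ← hg.rep_christoffel _ _ _ y]

lemma rep_laplacian (i j : Fin n) : Rep (fun y ↦ laplacian g h y i j)
    (Formal.laplacian (pdDer U) hg.chrA hg.invA hA i j) := fun y ↦ by
  simp only [laplacian, nabla₃, Formal.laplacian, Formal.nabla₃, Matrix.of_apply, map_sub, map_sum,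
    map_add, map_mul, ← (hg.rep_nabla₂ hh _ _ _).pd _ y, ← hg.rep_nabla₂ hh _ _ _ y,
    ← hg.rep_christoffel _ _ _ y, ← hg.rep_inv _ _ y]

lemma rep_nablaGrad {f : Coord n → ℝ} {φ : smoothFn U} (hf : Rep f φ) (i j : Fin n) :
    Rep (fun y ↦ nablaGrad g f h y i j)
      (Formal.nablaGrad (pdDer U) hg.chrA hg.invA φ hA i j) := fun y ↦ by
  simp only [nablaGrad, Formal.nablaGrad, Matrix.of_apply, map_sum, map_mul,
    ← hg.rep_nabla₂ hh _ _ _ y, ← hf.pd _ y, ← hg.rep_inv _ _ y]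

lemma rep_rmAction (i j : Fin n) : Rep (fun y ↦ rmAction g h y i j)
    (Formal.rmAction (pdDer U) hg.chrA hg.gA hg.invA hA i j) := fun y ↦ by
  simp only [rmAction, Formal.rmAction, Matrix.of_apply, map_sum, map_mul,
    ← hg.rep_riemann _ _ _ _ y, ← hh _ _ y, ← hg.rep_inv _ _ y]

end IsMetricOn

end Transfer

section Shrinker

variable {g h : Coord n → Matrix (Fin n) (Fin n) ℝ} {f : Coord n → ℝ}

variable (U g f) in
/-- The equations of a normalized shrinker on `U`. -/
structure IsShrinkerOn : Prop extends IsMetricOn U g where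
  smooth_potential : ContDiffOn ℝ ∞ f U
  soliton : ∀ y ∈ U, ricci g y + hessian g f y = (1 / 2 : ℝ) • g y
  normalized : ∀ y ∈ U, scalar g y + gradNormSq g f y = f y

namespace IsShrinkerOn

variable (s : IsShrinkerOn U g f)
include s

lemma soliton_formal : Formal.ricci (pdDer U) s.chrA
    + Formal.hessian (pdDer U) s.chrA (toSmooth f s.smooth_potential) = (1 / 2 : ℝ) • s.gA := by
  refine Matrix.ext fun i j ↦ smoothFn_ext fun y ↦ ?_
  have := congrFun₂ (s.soliton y y.2) i j
  rw [Matrix.add_apply, Matrix.smul_apply, map_add, map_smul, ← s.rep_ricci i j y,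
    ← s.rep_hessian (rep_toSmooth _) i j y, ← s.rep_metric i j y]
  exact this

lemma normalized_formal : Formal.scalar (pdDer U) s.chrA s.invA
    + Formal.gradNormSq (pdDer U) s.invA (toSmooth f s.smooth_potential)
      = toSmooth f s.smooth_potential :=
  smoothFn_ext fun y ↦ by
    rw [map_add, ← s.rep_scalar y, ← s.rep_gradNormSq (rep_toSmooth _) y]
    exact s.normalized y y.2

/-- The Lichnerowicz equation for the Ricci tensor in coordinates. The tensor `h` only has to agree
with the Ricci tensor on `U`. -/
theorem lichnerowicz_ricci (hh : ∀ y ∈ U, h y = ricci g y) (hy : y ∈ U) :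
    laplacian g h y - nablaGrad g f h y + (2 : ℝ) • rmAction g h y = h y := by
  have hA (i j : Fin n) : Rep (fun y ↦ h y i j) (Formal.ricci (pdDer U) s.chrA i j) := fun y ↦ by
    rw [← s.rep_ricci i j y]
    exact congrFun₂ (hh y y.2) i j
  ext i j
  have := congrArg (ev ⟨y, hy⟩) (congrFun₂
    (s.isLeviCivita.lichnerowicz_ricci _ s.soliton_formal s.normalized_formal) i j)
  rw [Matrix.add_apply, Matrix.sub_apply, Matrix.smul_apply, map_add, map_sub, map_smul,
    ← s.rep_laplacian hA i j, ← s.rep_nablaGrad hA (rep_toSmooth _) i j,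
    ← s.rep_rmAction hA i j, ← hA i j] at this
  exact this

/-- The Lichnerowicz equation for the Hessian of the potential in coordinates. -/
theorem lichnerowicz_hessian (hh : ∀ y ∈ U, h y = hessian g f y) (hy : y ∈ U) :
    laplacian g h y - nablaGrad g f h y + (2 : ℝ) • rmAction g h y = 0 := by
  have hA (i j : Fin n) : Rep (fun y ↦ h y i j) (Formal.hessian (pdDer U) s.chrA
      (toSmooth f s.smooth_potential) i j) := fun y ↦ by
    rw [← s.rep_hessian (rep_toSmooth _) i j y]
    exact congrFun₂ (hh y y.2) i j
  ext i j
  have := congrArg (ev ⟨y, hy⟩) (congrFun₂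
    (s.isLeviCivita.lichnerowicz_hessian _ s.soliton_formal s.normalized_formal) i j)
  rw [Matrix.add_apply, Matrix.sub_apply, Matrix.smul_apply, map_add, map_sub, map_smul,
    ← s.rep_laplacian hA i j, ← s.rep_nablaGrad hA (rep_toSmooth _) i j,
    ← s.rep_rmAction hA i j, Matrix.zero_apply, map_zero] at this
  exact this

end IsShrinkerOn

end Shrinker

end Shrinker.Local

end

/-! ### Transition maps -/

noncomputable section

namespace Shrinker.Local

open TopologicalSpace (Opens)

variable {n : ℕ} {V U : Opens (Coord n)} {ψ : Coord n → Coord n}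

/-- The Jacobian matrix of a map of the coordinate space, with entries `J i a = ∂_i ψ^a`. -/
def jacobian (ψ : Coord n → Coord n) (z : Coord n) : Matrix (Fin n) (Fin n) ℝ :=
  Matrix.of fun i a ↦ pd i (fun x ↦ ψ x a) z

lemma fderiv_single_eq_sum {z : Coord n} (hψ : DifferentiableAt ℝ ψ z) (i : Fin n) :
    fderiv ℝ ψ z (EuclideanSpace.single i 1)
      = ∑ a, jacobian ψ z i a • EuclideanSpace.single a (1 : ℝ) := by
  ext b
  have h1 : jacobian ψ z i b = fderiv ℝ ψ z (EuclideanSpace.single i 1) b := by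
    have : (fun x ↦ ψ x b) = (EuclideanSpace.proj b : Coord n →L[ℝ] ℝ) ∘ ψ := rfl
    rw [jacobian, Matrix.of_apply, pd, this,
      fderiv_comp _ (ContinuousLinearMap.differentiableAt _) hψ, ContinuousLinearMap.fderiv]
    rfl
  rw [← h1]
  simp [Pi.single_apply]

lemma pd_comp {z : Coord n} {F : Coord n → ℝ} (hF : DifferentiableAt ℝ F (ψ z))
    (hψ : DifferentiableAt ℝ ψ z) (i : Fin n) :
    pd i (F ∘ ψ) z = ∑ a, jacobian ψ z i a * pd a F (ψ z) := by
  rw [pd, fderiv_comp _ hF hψ, ContinuousLinearMap.comp_apply, fderiv_single_eq_sum hψ]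
  simp [pd]

section

variable (hψ : ContDiffOn ℝ ∞ ψ V) (hmaps : Set.MapsTo ψ V U)

/-- Substitution of a smooth map into smooth functions. -/
def pull : smoothFn U →ₐ[ℝ] smoothFn V where
  toFun φ := ⟨fun z ↦ ev ⟨ψ z, hmaps z.2⟩ φ, lift φ ∘ ψ, (contDiffOn_lift φ).comp hψ hmaps,
    fun z ↦ rep_lift φ ⟨ψ z, hmaps z.2⟩⟩
  map_one' := rfl
  map_zero' := rfl
  map_mul' _ _ := rfl
  map_add' _ _ := rfl
  commutes' _ := rfl

lemma ev_pull (z : V) (φ : smoothFn U) :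
    ev z (pull hψ hmaps φ) = ev ⟨ψ z, hmaps z.2⟩ φ := rfl

include hψ in
lemma contDiffOn_component (a : Fin n) : ContDiffOn ℝ ∞ (fun x ↦ ψ x a) V :=
  (EuclideanSpace.proj a : Coord n →L[ℝ] ℝ).contDiff.comp_contDiffOn hψ

/-- The Jacobian matrix with entries in the algebra of smooth functions. -/
def jacobianA : Matrix (Fin n) (Fin n) (smoothFn V) :=
  Matrix.of fun i a ↦ toSmooth _ (contDiffOn_pd (contDiffOn_component hψ a) i)

lemma ev_jacobianA (z : V) (i a : Fin n) : ev z (jacobianA hψ i a) = jacobian ψ z i a := rfl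

lemma isCoordChange :
    Formal.IsCoordChange (pdDer V) (pdDer U) (pull hψ hmaps) (jacobianA hψ) where
  chain i φ := smoothFn_ext fun z ↦ by
    have hr : Rep (lift φ ∘ ψ) (pull hψ hmaps φ) := fun z ↦ rep_lift φ ⟨ψ z, hmaps z.2⟩
    rw [← hr.pd i z, pd_comp (differentiableAt_lift φ ⟨ψ z, hmaps z.2⟩)
      ((hψ.contDiffAt (V.isOpen.mem_nhds z.2)).differentiableAt (by simp)), map_sum]
    refine Finset.sum_congr rfl fun a _ ↦ ?_
    rw [map_mul, ev_jacobianA, ev_pull, ← (rep_lift φ).pd a ⟨ψ z, hmaps z.2⟩]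
  symm i k a := smoothFn_ext fun z ↦ by
    have hr (i : Fin n) : Rep (pd i fun x ↦ ψ x a) (jacobianA hψ i a) := fun _ ↦ rfl
    rw [← (hr k).pd i z, ← (hr i).pd k z, pd_comm (contDiffOn_component hψ a) z.2]

variable {g g' : Coord n → Matrix (Fin n) (Fin n) ℝ} (hg : IsMetricOn V g)
  (hg' : IsMetricOn U g')
  (heq : ∀ z ∈ V, g z = jacobian ψ z * g' (ψ z) * (jacobian ψ z).transpose)
include hψ hmaps hg hg' heq

omit hmaps hg' in
/-- The Jacobian matrix is invertible, because it transforms one bilinear form into a nondegenerate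
one. -/
lemma exists_jacobianA_inv : ∃ K, K * jacobianA hψ = 1 := by
  have hdet (z : Coord n) (hz : z ∈ V) : (jacobian ψ z).det ≠ 0 := fun h0 ↦ by
    refine hg.nondeg z hz ?_
    rw [heq z hz, Matrix.det_mul, Matrix.det_mul, h0]; ring
  have hs (i a : Fin n) : ContDiffOn ℝ ∞ (fun z ↦ jacobian ψ z i a) V :=
    contDiffOn_pd (contDiffOn_component hψ a) i
  refine ⟨Matrix.of fun i j ↦ toSmooth _ (contDiffOn_inv hs hdet i j), ?_⟩
  refine Matrix.ext fun i j ↦ smoothFn_ext fun z ↦ ?_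
  rw [Matrix.mul_apply, map_sum]
  simp only [map_mul, ev_jacobianA, Matrix.of_apply, ev_toSmooth]
  rw [← Matrix.mul_apply, Matrix.nonsing_inv_mul _ (isUnit_iff_ne_zero.mpr (hdet z z.2))]
  exact (ev_one_apply z i j).symm

lemma gA_eq : hg.gA = jacobianA hψ * hg'.gA.map (pull hψ hmaps) * (jacobianA hψ).transpose := by
  refine Matrix.ext fun i j ↦ smoothFn_ext fun z ↦ ?_
  have := congrFun₂ (heq z z.2) i j
  simp only [Matrix.mul_apply, Matrix.map_apply, Matrix.transpose_apply, map_sum, map_mul,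
    ev_pull, ev_jacobianA, ← hg'.rep_metric _ _ ⟨ψ z, hmaps z.2⟩, ← hg.rep_metric _ _ z] at this ⊢
  exact this

/-- The Ricci tensor is independent of the coordinates. -/
theorem ricci_coordChange {z : Coord n} (hz : z ∈ V) :
    ricci g z = jacobian ψ z * ricci g' (ψ z) * (jacobian ψ z).transpose := by
  obtain ⟨K, hK⟩ := exists_jacobianA_inv hψ hg heq
  have := Formal.ricci_coordChange (isCoordChange hψ hmaps) hK hg.isLeviCivita hg'.isLeviCivita
    (gA_eq hψ hmaps hg hg' heq)
  ext i j
  have h := congrArg (ev ⟨z, hz⟩) (congrFun₂ this i j)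
  simp only [Matrix.mul_apply, Matrix.map_apply, Matrix.transpose_apply, map_sum, map_mul,
    ev_pull, ev_jacobianA, ← hg'.rep_ricci _ _ ⟨ψ z, hmaps hz⟩, ← hg.rep_ricci _ _ ⟨z, hz⟩] at h ⊢
  exact h

/-- The Hessian is independent of the coordinates. -/
theorem hessian_coordChange {f : Coord n → ℝ} (hf : ContDiffOn ℝ ∞ f U) {z : Coord n}
    (hz : z ∈ V) : hessian g (f ∘ ψ) z
      = jacobian ψ z * hessian g' f (ψ z) * (jacobian ψ z).transpose := by
  obtain ⟨K, hK⟩ := exists_jacobianA_inv hψ hg heq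
  have := Formal.hessian_coordChange (isCoordChange hψ hmaps) hK hg.isLeviCivita
    hg'.isLeviCivita (gA_eq hψ hmaps hg hg' heq) (toSmooth f hf)
  ext i j
  have h := congrArg (ev ⟨z, hz⟩) (congrFun₂ this i j)
  have hr : Rep (f ∘ ψ) (pull hψ hmaps (toSmooth f hf)) := fun _ ↦ rfl
  simp only [Matrix.mul_apply, Matrix.map_apply, Matrix.transpose_apply, map_sum, map_mul,
    ev_pull, ev_jacobianA, ← hg'.rep_hessian (rep_toSmooth hf) _ _ ⟨ψ z, hmaps hz⟩,
    ← hg.rep_hessian hr _ _ ⟨z, hz⟩] at h ⊢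
  exact h

end

end Shrinker.Local

end

/-! ### Components of tensor fields in charts -/

noncomputable section

namespace Shrinker

open TopologicalSpace (Opens)

variable {n : ℕ} {M : Type*} [TopologicalSpace M] [ChartedSpace (Coord n) M]

/-- The image of the chart around `x`. -/
def chartImage (x : M) : Opens (Coord n) :=
  ⟨(chartAt (Coord n) x).target, (chartAt (Coord n) x).open_target⟩

/-- The transition map from the chart around `x` to the chart around `p`. -/
def transition (x p : M) : Coord n → Coord n :=
  chartAt (Coord n) p ∘ (chartAt (Coord n) x).symm

/-- The set on which the transition map from the chart around `x` to the chart around `p` is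
defined. -/
def overlap (x p : M) : Opens (Coord n) :=
  ⟨((chartAt (Coord n) x).symm ≫ₕ chartAt (Coord n) p).source,
    ((chartAt (Coord n) x).symm ≫ₕ chartAt (Coord n) p).open_source⟩

lemma mem_overlap {x p : M} {z : Coord n} : z ∈ overlap x p ↔
    z ∈ (chartAt (Coord n) x).target ∧
      (chartAt (Coord n) x).symm z ∈ (chartAt (Coord n) p).source := by
  change z ∈ ((chartAt (Coord n) x).symm ≫ₕ chartAt (Coord n) p).source ↔ _
  simp

lemma mapsTo_transition (x p : M) :
    Set.MapsTo (transition (n := n) x p) (overlap (n := n) x p) (chartImage (n := n) p) :=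
  fun _ hz ↦ (chartAt (Coord n) p).map_source (mem_overlap.mp hz).2

/-- All tangent spaces are definitionally the model space, so equal base points may be exchanged
without transporting the vectors. -/
lemma tensor_congr (h : Tensor2 n M) {p q : M} (hpq : p = q) (v w : Coord n) :
    h p v w = h q v w := by
  subst hpq; rfl

variable [IsManifold (𝓡 n) ∞ M]

lemma contDiffOn_transition (x p : M) :
    ContDiffOn ℝ ∞ (transition (n := n) x p) (overlap (n := n) x p) := by
  rw [← contMDiffOn_iff_contDiffOn]
  exact (contMDiffOn_chart (I := 𝓡 n) (n := ∞) (x := p)).comp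
    ((contMDiffOn_chart_symm (I := 𝓡 n) (n := ∞) (x := x)).mono fun z hz ↦ (mem_overlap.mp hz).1)
    fun z hz ↦ (mem_overlap.mp hz).2

/-- In the trivialization of the bundle of bilinear forms given by the chart around `x`, a tensor is
represented by its components. -/
lemma trivializationAt_apply (h : Tensor2 n M) {x q : M} (hq : q ∈ (chartAt (Coord n) x).source)
    (i j : Fin n) :
    (trivializationAt (Coord n →L[ℝ] Coord n →L[ℝ] ℝ)
      (fun x : M ↦ TangentSpace (𝓡 n) x →L[ℝ] TangentSpace (𝓡 n) x →L[ℝ] Bundle.Trivial M ℝ x) x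
      ⟨q, h q⟩).2 (EuclideanSpace.single i 1) (EuclideanSpace.single j 1)
      = compAt x h (chartAt (Coord n) x q) i j := by
  have hb : q ∈ (trivializationAt (Coord n) (TangentSpace (𝓡 n)) x).baseSet := hq
  have e := inCoordinates_apply_eq₂ (ϕ := h q) (F₁ := Coord n) (F₂ := Coord n) (F₃ := ℝ)
    (E₃ := Bundle.Trivial M ℝ) (v := EuclideanSpace.single i 1) (w := EuclideanSpace.single j 1)
    hb hb (Set.mem_univ q)
  rw [hom_trivializationAt_apply]
  refine e.trans ?_
  have hs (v : Coord n) : (trivializationAt (Coord n) (TangentSpace (𝓡 n)) x).symm q v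
      = mfderiv (𝓡 n) (𝓡 n) (chartAt (Coord n) x).symm (chartAt (Coord n) x q) v := by
    have := TangentBundle.symmL_trivializationAt (I := 𝓡 n) hq
    rw [← Bundle.Trivialization.symmL_apply (R := ℝ) _ hb, this]
    simp [mfderivWithin_univ]
    rfl
  rw [hs, hs]
  trans h q (mfderiv (𝓡 n) (𝓡 n) (chartAt (Coord n) x).symm (chartAt (Coord n) x q)
    (EuclideanSpace.single i 1)) (mfderiv (𝓡 n) (𝓡 n) (chartAt (Coord n) x).symm (chartAt (Coord n) x q)
    (EuclideanSpace.single j 1))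
  · simp
  · exact tensor_congr h ((chartAt (Coord n) x).left_inv hq).symm _ _

/-- A bilinear form on the coordinate space in terms of its matrix. -/
lemma bilin_eq_sum (B : Coord n →L[ℝ] Coord n →L[ℝ] ℝ) : B
    = ∑ i, ∑ j, B (EuclideanSpace.single i 1) (EuclideanSpace.single j 1) •
      (EuclideanSpace.proj i : Coord n →L[ℝ] ℝ).smulRight
        (EuclideanSpace.proj j : Coord n →L[ℝ] ℝ) := by
  ext v w
  have hv (v : Coord n) : v = ∑ i, v i • EuclideanSpace.single i (1 : ℝ) := by
    ext b; simp [Pi.single_apply]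
  conv_lhs => rw [hv v, hv w]
  simp only [map_sum, map_smul, _root_.sum_apply, _root_.smul_apply,
    ContinuousLinearMap.smulRight_apply, PiLp.proj_apply, smul_eq_mul, Finset.mul_sum]
  rw [Finset.sum_comm]
  exact Finset.sum_congr rfl fun _ _ ↦ Finset.sum_congr rfl fun _ _ ↦ by ring

set_option synthInstance.maxHeartbeats 200000 in
/-- A tensor field is smooth if and only if its components in all charts are smooth. -/
lemma contMDiff_tensor_iff (h : Tensor2 n M) :
    ContMDiff (𝓡 n) ((𝓡 n).prod 𝓘(ℝ, Coord n →L[ℝ] Coord n →L[ℝ] ℝ)) ∞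
      (fun x ↦ Bundle.TotalSpace.mk' (Coord n →L[ℝ] Coord n →L[ℝ] ℝ)
        (E := fun x : M ↦ TangentSpace (𝓡 n) x →L[ℝ] TangentSpace (𝓡 n) x →L[ℝ] ℝ) x (h x))
    ↔ ∀ (x : M) (i j : Fin n),
      ContDiffOn ℝ ∞ (fun y ↦ compAt x h y i j) (chartImage (n := n) x) := by
  let T (x q : M) : Coord n →L[ℝ] Coord n →L[ℝ] ℝ :=
    (trivializationAt (Coord n →L[ℝ] Coord n →L[ℝ] ℝ)
      (fun x : M ↦ TangentSpace (𝓡 n) x →L[ℝ] TangentSpace (𝓡 n) x →L[ℝ] Bundle.Trivial M ℝ x) x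
      ⟨q, h q⟩).2
  have hbase (x : M) : (trivializationAt (Coord n →L[ℝ] Coord n →L[ℝ] ℝ)
      (fun x : M ↦ TangentSpace (𝓡 n) x →L[ℝ] TangentSpace (𝓡 n) x →L[ℝ] Bundle.Trivial M ℝ x)
      x).baseSet = (chartAt (Coord n) x).source := by
    simp
  have key (x : M) : ContMDiffOn (𝓡 n) ((𝓡 n).prod 𝓘(ℝ, Coord n →L[ℝ] Coord n →L[ℝ] ℝ)) ∞
      (fun x ↦ Bundle.TotalSpace.mk' (Coord n →L[ℝ] Coord n →L[ℝ] ℝ)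
        (E := fun x : M ↦ TangentSpace (𝓡 n) x →L[ℝ] TangentSpace (𝓡 n) x →L[ℝ] ℝ) x (h x))
        (chartAt (Coord n) x).source
      ↔ ContMDiffOn (𝓡 n) 𝓘(ℝ, Coord n →L[ℝ] Coord n →L[ℝ] ℝ) ∞ (T x)
        (chartAt (Coord n) x).source := by
    rw [← hbase x]
    exact Bundle.Trivialization.contMDiffOn_section_baseSet_iff _
  constructor
  · intro hs x i j
    have h1 := ((key x).mp hs.contMDiffOn).comp
      (contMDiffOn_chart_symm (I := 𝓡 n) (n := ∞) (x := x))
      fun y hy ↦ (chartAt (Coord n) x).map_target hy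
    rw [contMDiffOn_iff_contDiffOn] at h1
    refine ((h1.clm_apply (contDiffOn_const (c := EuclideanSpace.single i 1))).clm_apply
      (contDiffOn_const (c := EuclideanSpace.single j 1))).congr fun y hy ↦ ?_
    have := trivializationAt_apply h ((chartAt (Coord n) x).map_target hy) i j
    rw [(chartAt (Coord n) x).right_inv hy] at this
    exact this.symm
  · intro hs x
    refine ContMDiffOn.contMDiffAt ((key x).mpr ?_) ((chartAt (Coord n) x).open_source.mem_nhds
      (mem_chart_source _ x))
    have h1 : ContDiffOn ℝ ∞ (fun y ↦ ∑ i, ∑ j, compAt x h y i j •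
        (EuclideanSpace.proj i : Coord n →L[ℝ] ℝ).smulRight
          (EuclideanSpace.proj j : Coord n →L[ℝ] ℝ)) (chartImage (n := n) x) := by
      refine contDiffOn_clm_apply.mpr fun v ↦ contDiffOn_clm_apply.mpr fun w ↦ ?_
      simp only [_root_.sum_apply, _root_.smul_apply]
      exact ContDiffOn.sum fun i _ ↦ ContDiffOn.sum fun j _ ↦ (hs x i j).mul contDiffOn_const
    refine (h1.contMDiffOn.comp (contMDiffOn_chart (I := 𝓡 n) (n := ∞) (x := x))
      fun q hq ↦ (chartAt (Coord n) x).map_source hq).congr fun q hq ↦ ?_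
    rw [bilin_eq_sum (T x q)]
    simp only [T, trivializationAt_apply h hq]
    rfl

lemma mfderiv_chart_symm_injective (x : M) {z : Coord n} (hz : z ∈ (chartAt (Coord n) x).target) :
    Function.Injective (mfderiv (𝓡 n) (𝓡 n) (chartAt (Coord n) x).symm z) :=
  (mdifferentiable_chart (I := 𝓡 n) x).symm.mfderiv_injective hz

/-- The components of a Riemannian metric are smooth, symmetric and nondegenerate. -/
lemma isMetricOn_compAt (g : Metric n M) (x : M) :
    Local.IsMetricOn (chartImage x) (compAt x g.inner) where
  smooth := (contMDiff_tensor_iff g.inner).mp g.contMDiff x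
  symm y _ i j := g.symm _ _ _
  nondeg y hy := by
    intro h0
    obtain ⟨v, hv, hv0⟩ := Matrix.exists_mulVec_eq_zero_iff.mpr h0
    set L : Coord n →L[ℝ] Coord n := mfderiv (𝓡 n) (𝓡 n) (chartAt (Coord n) x).symm y
    set V : Coord n := ∑ j, v j • EuclideanSpace.single j (1 : ℝ) with hV
    have hLV : L V = 0 := by
      by_contra hne
      refine (g.pos ((chartAt (Coord n) x).symm y) (L V) hne).ne' ?_
      let B : Coord n →L[ℝ] Coord n →L[ℝ] ℝ := g.inner ((chartAt (Coord n) x).symm y)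
      change B (L V) (L V) = 0
      have : ∀ i, B (L (EuclideanSpace.single i 1)) (L V) = 0 := fun i ↦ by
        rw [hV]
        simp only [map_sum, map_smul]
        have := congrFun hv0 i
        simp only [Matrix.mulVec, dotProduct, Pi.zero_apply] at this
        rw [← this]
        exact Finset.sum_congr rfl fun j _ ↦ mul_comm _ _
      conv_lhs => enter [1]; rw [hV]
      simp only [map_sum, map_smul, _root_.sum_apply,
        _root_.smul_apply, this, smul_zero, Finset.sum_const_zero]
    have hV0 : V = 0 := mfderiv_chart_symm_injective x hy (hLV.trans (map_zero L).symm)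
    refine hv (funext fun i ↦ ?_)
    have := congrArg (fun w : Coord n ↦ w i) hV0
    simpa [hV, Pi.single_apply] using this

end Shrinker

end

/-! ### Independence of the chart -/

noncomputable section

namespace Shrinker

open TopologicalSpace (Opens)

namespace Local

variable {n : ℕ}

lemma IsMetricOn.mono {U V : Opens (Coord n)} {g : Coord n → Matrix (Fin n) (Fin n) ℝ}
    (hg : IsMetricOn U g) (h : V ≤ U) : IsMetricOn V g where
  smooth i j := (hg.smooth i j).mono h
  symm y hy := hg.symm y (h hy)
  nondeg y hy := hg.nondeg y (h hy)

lemma hessian_congr {V : Opens (Coord n)} (g : Coord n → Matrix (Fin n) (Fin n) ℝ)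
    {F F' : Coord n → ℝ} (h : ∀ z ∈ V, F z = F' z) {z : Coord n} (hz : z ∈ V) :
    hessian g F z = hessian g F' z := by
  ext i j
  simp only [hessian, pd_congr h _ hz, pd_congr (fun y hy ↦ pd_congr h j hy) i hz]

/-- The contraction of two bilinear forms is independent of the basis. -/
lemma sum_inv_mul_congr {g g' S S' J : Matrix (Fin n) (Fin n) ℝ} (hg : g = J * g' * J.transpose)
    (hS : S = J * S' * J.transpose) (hdet : g.det ≠ 0) :
    ∑ i, ∑ j, g⁻¹ i j * S i j = ∑ i, ∑ j, g'⁻¹ i j * S' i j := by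
  have key (A B : Matrix (Fin n) (Fin n) ℝ) :
      ∑ i, ∑ j, A i j * B i j = (A * B.transpose).trace := by
    simp [Matrix.trace, Matrix.mul_apply]
  have hJ : IsUnit J.det := by
    refine isUnit_iff_ne_zero.mpr fun h0 ↦ hdet ?_
    rw [hg, Matrix.det_mul, Matrix.det_mul, h0]; ring
  have hJT : IsUnit J.transpose.det := by rwa [Matrix.det_transpose]
  have hST : S.transpose = J * S'.transpose * J.transpose := by
    rw [hS, Matrix.transpose_mul, Matrix.transpose_mul, Matrix.transpose_transpose, mul_assoc]
  rw [key, key, hST, hg, Matrix.mul_inv_rev, Matrix.mul_inv_rev]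
  calc (J.transpose⁻¹ * (g'⁻¹ * J⁻¹) * (J * S'.transpose * J.transpose)).trace
      = (J.transpose⁻¹ * (g'⁻¹ * (J⁻¹ * J) * S'.transpose * J.transpose)).trace := by
        simp only [mul_assoc]
    _ = (g'⁻¹ * S'.transpose).trace := by
        rw [Matrix.nonsing_inv_mul _ hJ, mul_one, Matrix.trace_mul_comm, mul_assoc,
          Matrix.mul_nonsing_inv _ hJT, mul_one]

end Local

variable {n : ℕ} {M : Type*} [TopologicalSpace M] [ChartedSpace (Coord n) M]
  [IsManifold (𝓡 n) ∞ M]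

lemma differentiableAt_transition {x p : M} {z : Coord n} (hz : z ∈ overlap x p) :
    DifferentiableAt ℝ (transition (n := n) x p) z :=
  ((contDiffOn_transition x p).contDiffAt ((overlap x p).isOpen.mem_nhds hz)).differentiableAt
    (by simp)

/-- The coordinate vector fields of two charts are related by the Jacobian of the transition. -/
lemma mfderiv_chart_symm_eq {x p : M} {z : Coord n} (hz : z ∈ overlap x p) (v : Coord n) :
    (mfderiv (𝓡 n) (𝓡 n) (chartAt (Coord n) x).symm z v : Coord n)
      = mfderiv (𝓡 n) (𝓡 n) (chartAt (Coord n) p).symm (transition x p z)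
        (fderiv ℝ (transition x p) z v) := by
  have h1 : (chartAt (Coord n) x).symm =ᶠ[nhds z]
      (chartAt (Coord n) p).symm ∘ transition x p := by
    filter_upwards [(overlap x p).isOpen.mem_nhds hz] with y hy
    exact ((chartAt (Coord n) p).left_inv (mem_overlap.mp hy).2).symm
  have h2 : MDifferentiableAt (𝓡 n) (𝓡 n) (chartAt (Coord n) p).symm (transition x p z) :=
    (mdifferentiable_chart (I := 𝓡 n) p).mdifferentiableAt_symm (mapsTo_transition x p hz)
  have h3 : MDifferentiableAt (𝓡 n) (𝓡 n) (transition (n := n) x p) z :=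
    (differentiableAt_transition hz).mdifferentiableAt
  have h4 := mfderiv_comp z h2 h3
  rw [mfderiv_eq_fderiv] at h4
  have h5 := h1.mfderiv_eq (I := 𝓡 n) (I' := 𝓡 n)
  exact (DFunLike.congr_fun h5 v).trans (DFunLike.congr_fun h4 v)

/-- The derivative of a chart on the coordinate vector fields of another chart. -/
lemma mfderiv_chart_mfderiv_symm {x p : M} {z : Coord n} (hz : z ∈ overlap x p) (v : Coord n) :
    (mfderiv (𝓡 n) (𝓡 n) (chartAt (Coord n) p) ((chartAt (Coord n) x).symm z)
      (mfderiv (𝓡 n) (𝓡 n) (chartAt (Coord n) x).symm z v) : Coord n)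
      = fderiv ℝ (transition x p) z v := by
  have h1 : MDifferentiableAt (𝓡 n) (𝓡 n) (chartAt (Coord n) x).symm z :=
    (mdifferentiable_chart (I := 𝓡 n) x).mdifferentiableAt_symm (mem_overlap.mp hz).1
  have h2 : MDifferentiableAt (𝓡 n) (𝓡 n) (chartAt (Coord n) p) ((chartAt (Coord n) x).symm z) :=
    (mdifferentiable_chart (I := 𝓡 n) p).mdifferentiableAt (mem_overlap.mp hz).2
  have h3 := mfderiv_comp z h2 h1
  have h4 : mfderiv (𝓡 n) (𝓡 n) (transition (n := n) x p) z = fderiv ℝ (transition x p) z :=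
    mfderiv_eq_fderiv
  exact (DFunLike.congr_fun h3 v).symm.trans (DFunLike.congr_fun h4 v)

/-- The components of a tensor in two charts are related by the Jacobian of the transition. -/
lemma compAt_eq {x p : M} (h : Tensor2 n M) {z : Coord n} (hz : z ∈ overlap x p) :
    compAt x h z = Local.jacobian (transition x p) z * compAt p h (transition x p z)
      * (Local.jacobian (transition x p) z).transpose := by
  set J := Local.jacobian (transition (n := n) x p) z with hJ
  let L : Coord n →L[ℝ] Coord n :=
    mfderiv (𝓡 n) (𝓡 n) (chartAt (Coord n) p).symm (transition x p z)
  have hv (i : Fin n) : (mfderiv (𝓡 n) (𝓡 n) (chartAt (Coord n) x).symm z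
      (EuclideanSpace.single i 1) : Coord n)
      = ∑ a, J i a • L (EuclideanSpace.single a 1) := by
    rw [mfderiv_chart_symm_eq hz,
      Local.fderiv_single_eq_sum (differentiableAt_transition hz)]
    change L _ = _
    simp only [map_sum, map_smul, hJ]
  have hpt : (chartAt (Coord n) x).symm z = (chartAt (Coord n) p).symm (transition x p z) :=
    ((chartAt (Coord n) p).left_inv (mem_overlap.mp hz).2).symm
  let B : Coord n →L[ℝ] Coord n →L[ℝ] ℝ := h ((chartAt (Coord n) p).symm (transition x p z))
  ext i j
  have e : compAt x h z i j = B (∑ a, J i a • L (EuclideanSpace.single a 1))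
      (∑ a, J j a • L (EuclideanSpace.single a 1)) := by
    rw [← hv, ← hv]
    exact tensor_congr h hpt _ _
  rw [e]
  simp only [map_sum, map_smul, _root_.sum_apply, _root_.smul_apply, smul_eq_mul,
    Matrix.mul_apply, Matrix.transpose_apply, Finset.sum_mul, Finset.mul_sum]
  refine Finset.sum_congr rfl fun b _ ↦ Finset.sum_congr rfl fun a _ ↦ ?_
  change _ = J i a * B (L (EuclideanSpace.single a 1)) (L (EuclideanSpace.single b 1)) * J j b
  ring

omit [IsManifold (𝓡 n) ∞ M] in
lemma mem_overlap_self {x : M} {z : Coord n} (hz : z ∈ chartImage (n := n) x) :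
    z ∈ overlap x ((chartAt (Coord n) x).symm z) :=
  mem_overlap.mpr ⟨hz, mem_chart_source _ _⟩

omit [IsManifold (𝓡 n) ∞ M] in
lemma ofComp_apply (x : M) (a : Matrix (Fin n) (Fin n) ℝ) (v w : TangentSpace (𝓡 n) x) :
    ofComp x a v w = ∑ i, ∑ j, a i j * (dcoord n x i v * dcoord n x j w) := by
  simp only [ofComp, _root_.sum_apply, _root_.smul_apply]
  rfl

/-- The components in the chart around `x` of a tensor field given pointwise by components in the
preferred charts. -/
lemma compAt_ofComp (x : M) (a : M → Matrix (Fin n) (Fin n) ℝ) {z : Coord n}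
    (hz : z ∈ chartImage (n := n) x) :
    compAt x (fun p ↦ ofComp p (a p)) z
      = Local.jacobian (transition x ((chartAt (Coord n) x).symm z)) z
        * a ((chartAt (Coord n) x).symm z)
        * (Local.jacobian (transition x ((chartAt (Coord n) x).symm z)) z).transpose := by
  set p := (chartAt (Coord n) x).symm z with hp
  have hd (i k : Fin n) : dcoord n p k (mfderiv (𝓡 n) (𝓡 n) (chartAt (Coord n) x).symm z
      (EuclideanSpace.single i 1)) = Local.jacobian (transition x p) z i k := by
    have h1 := mfderiv_chart_mfderiv_symm (mem_overlap_self hz) (EuclideanSpace.single i 1)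
    rw [Local.fderiv_single_eq_sum (differentiableAt_transition (mem_overlap_self hz))] at h1
    have := congrArg (fun v : Coord n ↦ v k) h1
    refine this.trans ?_
    simp [Pi.single_apply, hp]
  ext i j
  have e := ofComp_apply p (a p) (mfderiv (𝓡 n) (𝓡 n) (chartAt (Coord n) x).symm z
    (EuclideanSpace.single i 1)) (mfderiv (𝓡 n) (𝓡 n) (chartAt (Coord n) x).symm z
    (EuclideanSpace.single j 1))
  refine e.trans ?_
  simp only [hd, Matrix.mul_apply, Matrix.transpose_apply, Finset.sum_mul]
  rw [Finset.sum_comm]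
  exact Finset.sum_congr rfl fun _ _ ↦ Finset.sum_congr rfl fun _ _ ↦ by ring

section Invariance

variable (g : Metric n M) (x : M) {z : Coord n}

lemma isMetricOn_overlap (p : M) : Local.IsMetricOn (overlap x p) (compAt x g.inner) :=
  (isMetricOn_compAt g x).mono fun _ hz ↦ (mem_overlap.mp hz).1

/-- The Ricci tensor may be computed in any chart. -/
lemma compAt_ricci (hz : z ∈ chartImage (n := n) x) :
    compAt x (ricci g) z = Local.ricci (compAt x g.inner) z := by
  set p := (chartAt (Coord n) x).symm z with hp
  rw [Local.ricci_coordChange (contDiffOn_transition x p) (mapsTo_transition x p)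
    (isMetricOn_overlap g x p) (isMetricOn_compAt g p) (fun _ hy ↦ compAt_eq g.inner hy)
    (mem_overlap_self hz)]
  exact compAt_ofComp x _ hz

lemma contDiffOn_fnAt {f : M → ℝ} (hf : ContMDiff (𝓡 n) 𝓘(ℝ, ℝ) ∞ f) :
    ContDiffOn ℝ ∞ (fnAt (n := n) x f) (chartImage (n := n) x) := by
  rw [← contMDiffOn_iff_contDiffOn]
  exact hf.comp_contMDiffOn (contMDiffOn_chart_symm (I := 𝓡 n) (n := ∞) (x := x))

omit [IsManifold (𝓡 n) ∞ M] in
lemma fnAt_transition (f : M → ℝ) (p : M) :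
    ∀ y ∈ overlap (n := n) x p, (fnAt p f ∘ transition x p) y = fnAt x f y := fun _ hy ↦
  congrArg f ((chartAt (Coord n) p).left_inv (mem_overlap.mp hy).2)

/-- The Hessian may be computed in any chart. -/
lemma compAt_hessian {f : M → ℝ} (hf : ContMDiff (𝓡 n) 𝓘(ℝ, ℝ) ∞ f)
    (hz : z ∈ chartImage (n := n) x) :
    compAt x (hessian g f) z = Local.hessian (compAt x g.inner) (fnAt x f) z := by
  set p := (chartAt (Coord n) x).symm z with hp
  rw [← Local.hessian_congr _ (fnAt_transition x f p) (mem_overlap_self hz),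
    Local.hessian_coordChange (contDiffOn_transition x p) (mapsTo_transition x p)
    (isMetricOn_overlap g x p) (isMetricOn_compAt g p) (fun _ hy ↦ compAt_eq g.inner hy)
    (contDiffOn_fnAt p hf) (mem_overlap_self hz)]
  exact compAt_ofComp x _ hz

/-- The scalar curvature may be computed in any chart. -/
lemma scalarCurvature_eq (hz : z ∈ chartImage (n := n) x) :
    scalarCurvature g ((chartAt (Coord n) x).symm z) = Local.scalar (compAt x g.inner) z := by
  set p := (chartAt (Coord n) x).symm z with hp
  exact (Local.sum_inv_mul_congr (compAt_eq g.inner (mem_overlap_self hz))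
    (Local.ricci_coordChange (contDiffOn_transition x p) (mapsTo_transition x p)
      (isMetricOn_overlap g x p) (isMetricOn_compAt g p) (fun _ hy ↦ compAt_eq g.inner hy)
      (mem_overlap_self hz)) ((isMetricOn_compAt g x).nondeg z hz)).symm

/-- The norm of the gradient may be computed in any chart. -/
lemma gradNormSq_eq {f : M → ℝ} (hf : ContMDiff (𝓡 n) 𝓘(ℝ, ℝ) ∞ f)
    (hz : z ∈ chartImage (n := n) x) : gradNormSq g f ((chartAt (Coord n) x).symm z)
      = Local.gradNormSq (compAt x g.inner) (fnAt x f) z := by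
  set p := (chartAt (Coord n) x).symm z with hp
  have hzp := mem_overlap_self hz
  have hpd (i : Fin n) : Local.pd i (fnAt x f) z
      = ∑ a, Local.jacobian (transition x p) z i a * Local.pd a (fnAt p f) (transition x p z) := by
    rw [← Local.pd_congr (fnAt_transition x f p) i hzp]
    exact Local.pd_comp (Local.differentiableAt_of_contDiffOn (contDiffOn_fnAt p hf)
      (mapsTo_transition x p hzp)) (differentiableAt_transition hzp) i
  have hS : Matrix.of (fun i j ↦ Local.pd i (fnAt x f) z * Local.pd j (fnAt x f) z)
      = Local.jacobian (transition x p) z * Matrix.of (fun a b ↦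
        Local.pd a (fnAt p f) (transition x p z) * Local.pd b (fnAt p f) (transition x p z))
        * (Local.jacobian (transition x p) z).transpose := by
    ext i j
    simp only [hpd, Matrix.of_apply, Matrix.mul_apply, Matrix.transpose_apply, Finset.sum_mul,
      Finset.mul_sum]
    exact Finset.sum_congr rfl fun _ _ ↦ Finset.sum_congr rfl fun _ _ ↦ by ring
  have := Local.sum_inv_mul_congr (compAt_eq g.inner hzp) hS
    ((isMetricOn_compAt g x).nondeg z hz)
  simp only [Matrix.of_apply, ← mul_assoc] at this
  exact this.symm

/-- The shrinker equations in a chart. -/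
lemma IsShrinker.isShrinkerOn {g : Metric n M} {f : M → ℝ} (s : IsShrinker g f) (x : M) :
    Local.IsShrinkerOn (chartImage x) (compAt x g.inner) (fnAt x f) where
  toIsMetricOn := isMetricOn_compAt g x
  smooth_potential := contDiffOn_fnAt x s.smooth
  soliton z hz := by
    rw [← compAt_ricci g x hz, ← compAt_hessian g x s.smooth hz]
    ext i j
    exact DFunLike.congr_fun (DFunLike.congr_fun (s.soliton ((chartAt (Coord n) x).symm z))
      (mfderiv (𝓡 n) (𝓡 n) (chartAt (Coord n) x).symm z (EuclideanSpace.single i 1)))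
      (mfderiv (𝓡 n) (𝓡 n) (chartAt (Coord n) x).symm z (EuclideanSpace.single j 1))
  normalized z hz := by
    rw [← scalarCurvature_eq g x hz, ← gradNormSq_eq g x s.smooth hz]
    exact s.normalized _

end Invariance

end Shrinker

end

/-! ### The weighted Lichnerowicz Laplacian on the manifold -/

namespace Shrinker

section

variable {n : ℕ} {M : Type*} [TopologicalSpace M] [ChartedSpace (Coord n) M]

lemma ofComp_add (x : M) (a b : Matrix (Fin n) (Fin n) ℝ) :
    ofComp x (a + b) = ofComp x a + ofComp x b := by
  ext v w
  rw [_root_.add_apply, _root_.add_apply]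
  simp only [ofComp_apply, Matrix.add_apply, add_mul, Finset.sum_add_distrib]

lemma ofComp_sub (x : M) (a b : Matrix (Fin n) (Fin n) ℝ) :
    ofComp x (a - b) = ofComp x a - ofComp x b := by
  ext v w
  rw [_root_.sub_apply, _root_.sub_apply]
  simp only [ofComp_apply, Matrix.sub_apply, sub_mul, Finset.sum_sub_distrib]

lemma ofComp_smul (x : M) (c : ℝ) (a : Matrix (Fin n) (Fin n) ℝ) :
    ofComp x (c • a) = c • ofComp x a := by
  simp only [ofComp, Matrix.smul_apply, smul_assoc, Finset.smul_sum]

lemma ofComp_zero (x : M) : ofComp x (0 : Matrix (Fin n) (Fin n) ℝ) = 0 := by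
  ext v w
  simp only [ofComp_apply, Matrix.zero_apply, zero_mul, Finset.sum_const_zero]
  rfl

lemma ofComp_symm (x : M) {a : Matrix (Fin n) (Fin n) ℝ} (ha : ∀ i j, a i j = a j i)
    (v w : TangentSpace (𝓡 n) x) : ofComp x a v w = ofComp x a w v := by
  rw [ofComp_apply, ofComp_apply, Finset.sum_comm]
  refine Finset.sum_congr rfl fun i _ ↦ Finset.sum_congr rfl fun j _ ↦ ?_
  rw [ha j i, mul_comm (dcoord n x j v)]

lemma coords_mem_chartImage (x : M) : coords x ∈ chartImage (n := n) x :=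
  mem_chart_target _ x

variable [IsManifold (𝓡 n) ∞ M]

lemma isSmoothSym_ricci (g : Metric n M) : IsSmoothSym (ricci g) where
  smooth := (contMDiff_tensor_iff _).mpr fun x i j ↦
    ((isMetricOn_compAt g x).rep_ricci i j).contDiffOn.congr fun _ hz ↦
      congrFun₂ (compAt_ricci g x hz) i j
  symm x v w := ofComp_symm x (fun i j ↦ by
    have hg := isMetricOn_compAt g x
    have e (i j : Fin n) := hg.rep_ricci i j ⟨coords x, coords_mem_chartImage x⟩
    exact (e i j).trans ((congrArg _ (hg.isLeviCivita.ricci_symm i j)).trans (e j i).symm)) v w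

lemma isSmoothSym_hessian (g : Metric n M) {f : M → ℝ} (hf : ContMDiff (𝓡 n) 𝓘(ℝ, ℝ) ∞ f) :
    IsSmoothSym (hessian g f) where
  smooth := (contMDiff_tensor_iff _).mpr fun x i j ↦
    ((isMetricOn_compAt g x).rep_hessian
      (Local.rep_toSmooth (contDiffOn_fnAt x hf)) i j).contDiffOn.congr fun _ hz ↦
      congrFun₂ (compAt_hessian g x hf hz) i j
  symm x v w := ofComp_symm x (fun i j ↦ by
    have hg := isMetricOn_compAt g x
    have e (i j : Fin n) := hg.rep_hessian (Local.rep_toSmooth (contDiffOn_fnAt x hf)) i j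
      ⟨coords x, coords_mem_chartImage x⟩
    exact (e i j).trans ((congrArg _ (Formal.hessian_symm hg.isLeviCivita.comm
      hg.isLeviCivita.torsion _ i j)).trans (e j i).symm)) v w

lemma weightedLichnerowicz_eq_ofComp (g : Metric n M) (f : M → ℝ) (h : Tensor2 n M) (x : M) :
    weightedLaplacian g f h x + (2 : ℝ) • rmAction g h x
      = ofComp x (Local.laplacian (compAt x g.inner) (compAt x h) (coords x)
        - Local.nablaGrad (compAt x g.inner) (fnAt x f) (compAt x h) (coords x)
        + (2 : ℝ) • Local.rmAction (compAt x g.inner) (compAt x h) (coords x)) := by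
  rw [ofComp_add, ofComp_sub, ofComp_smul]
  rfl

namespace IsShrinker

variable {g : Metric n M} {f : M → ℝ} (s : IsShrinker g f)
include s

theorem weightedLichnerowicz_ricci (x : M) :
    weightedLaplacian g f (ricci g) x + (2 : ℝ) • rmAction g (ricci g) x = ricci g x := by
  rw [weightedLichnerowicz_eq_ofComp, (s.isShrinkerOn x).lichnerowicz_ricci
    (fun _ hz ↦ compAt_ricci g x hz) (coords_mem_chartImage x),
    compAt_ricci g x (coords_mem_chartImage x)]
  rfl

theorem weightedLichnerowicz_hessian (x : M) :
    weightedLaplacian g f (hessian g f) x + (2 : ℝ) • rmAction g (hessian g f) x = 0 := by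
  rw [weightedLichnerowicz_eq_ofComp, (s.isShrinkerOn x).lichnerowicz_hessian
    (fun _ hz ↦ compAt_hessian g x s.smooth hz) (coords_mem_chartImage x), ofComp_zero]

end IsShrinker

end

end Shrinker

theorem mainTheorem6 {n : ℕ} {M : Type*} [TopologicalSpace M]
    [ChartedSpace (EuclideanSpace ℝ (Fin n)) M] [IsManifold (𝓡 n) ∞ M]
    (g : Bundle.ContMDiffRiemannianMetric (𝓡 n) ∞ (EuclideanSpace ℝ (Fin n))
      (fun x : M ↦ TangentSpace (𝓡 n) x))
    (f : M → ℝ) (hgf : Shrinker.IsShrinker g f) :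
    ((∀ x, Shrinker.weightedLaplacian g f (Shrinker.ricci g) x
          + (2 : ℝ) • Shrinker.rmAction g (Shrinker.ricci g) x = Shrinker.ricci g x) ∧
      ((∃ x, Shrinker.ricci g x ≠ 0) →
        Shrinker.IsEigenmode g f (Shrinker.ricci g) 1)) ∧
    ((∀ x, Shrinker.weightedLaplacian g f (Shrinker.hessian g f) x
          + (2 : ℝ) • Shrinker.rmAction g (Shrinker.hessian g f) x = 0) ∧
      ((∃ x, Shrinker.hessian g f x ≠ 0) →
        Shrinker.IsEigenmode g f (Shrinker.hessian g f) 0)) := by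
  refine ⟨⟨hgf.weightedLichnerowicz_ricci, fun hne ↦ ⟨Shrinker.isSmoothSym_ricci g, hne,
    fun x ↦ ?_⟩⟩, hgf.weightedLichnerowicz_hessian, fun hne ↦
    ⟨Shrinker.isSmoothSym_hessian g hgf.smooth, hne, fun x ↦ ?_⟩⟩
  · rw [one_smul]
    exact hgf.weightedLichnerowicz_ricci x
  · refine (hgf.weightedLichnerowicz_hessian x).trans ?_
    ext v w
    exact (zero_mul _).symm
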